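/- Let $n\ge 1$. For $u\in L^1(\mathbb R^n)$ let $$\mathbf V(u)=\sup\Bigl\{\int u\,\operatorname{div}\varphi : \varphi\in C^1_c(\mathbb R^n,\mathbb R^n),\ \|\varphi\|_\infty\le 1\Bigr\}$$ be the total variation, and write $\operatorname{BV}(\mathbb R^n)$ for the set of $u\in L^1(\mathbb R^n)$ with $\mathbf V(u)<\infty$. For $\alpha\in[0,1]$ let $$\mathbf V^\alpha(u)=\sup\Bigl|\int_{\mathbb R^n}u(x)\det D(f,g^1,\dots,g^{n-1})_x\,dx\Bigr|,$$ where the supremum is over all Lipschitz functions $f,g^1,\dots,g^{n-1}:\mathbb R^n\to\mathbb R$ such that $f$ has compact support, $|f(x)-f(y)|\le|x-y|^\alpha$ for all $x\ne y$, and $|g^i(x)-g^i(y)|\le|x-y|$ for all $x,y$ and $i$. Let $L^p_c(\mathbb R^n)$ be the set of functions in $L^p(\mathbb R^n)$ with compact support and $\operatorname{BV}^\alpha_c(\mathbb R^n)=\{u\in L^1_c(\mathbb R^n):\mathbf V^\alpha(u)<\infty\}$. **Proposition (Higher integrability).** Let $0\le\alpha<1$ and $1\le p<\frac{n}{n-1+\alpha}$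 (that is, $1\le p<\infty$ if $n=1$ and $\alpha=0$). 1. For every $\sigma>1$ there is a constant $C=C(n,\alpha,\sigma,p)\ge 0$ such that the following holds. If $V\ge 0$ and $(u_k)_{k\ge 0}$ is a sequence in $\operatorname{BV}(\mathbb R^n)$ with $$\|u_k\|_{L^1}\le V\sigma^{k(\alpha-1)}\quad\text{and}\quad\mathbf V(u_k)\le V\sigma^{k\alpha}\qquad\text{for all }k\ge 0,$$ then $\sum_{k\ge 0}u_k$ converges in $L^1(\mathbb R^n)$ and, absolutely, almost everywhere to some $u\in L^1(\mathbb R^n)$, and $u\in L^p(\mathbb R^n)$ with $\|u\|_{L^p}\le C\,V$. 2. $\operatorname{BV}^\alpha_c(\mathbb R^n)\subset L^p_c(\mathbb R^n)$. 3. For every compact $K\subset\mathbb R^n$ the inclusion $\{u\in\operatorname{BV}^\alpha_c(\mathbb R^n):\operatorname{spt}(u)\subset K\}\hookrightarrow L^p_c(\mathbb R^n)$ is compact: every sequence $(u_j)$ in $\operatorname{BV}^\alpha_c(\mathbb R^n)$ with $\operatorname{spt}(u_j)\subset K$ for all $j$ and $\sup_j\bigl(\|u_j\|_{L^1}+\mathbf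 V^\alpha(u_j)\bigr)<\infty$ has a subsequence that converges in $L^p$ to a function in $L^p_c(\mathbb R^n)$ with support in $K$. -/

import Mathlib

open MeasureTheory Filter Topology
open scoped NNReal ENNReal

noncomputable section

namespace FracBV

/-- Euclidean space of dimension `n`. -/
abbrev Euc (n : ℕ) : Type := EuclideanSpace ℝ (Fin n)

/-- The divergence of a vector field on Euclidean space. -/
def divergence {n : ℕ} (φ : Euc n → Euc n) (x : Euc n) : ℝ :=
  ∑ i : Fin n, fderiv ℝ φ x (EuclideanSpace.single i 1) i

/-- The classical total variation of `u`: the supremum of the integrals of `u * div φ` over all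
compactly supported `C¹` vector fields `φ` whose (Euclidean) norm is bounded by `1`. -/
def totalVariation {n : ℕ} (u : Euc n → ℝ) : ℝ≥0∞ :=
  ⨆ (φ : Euc n → Euc n) (_ : ContDiff ℝ 1 φ) (_ : HasCompactSupport φ) (_ : ∀ x, ‖φ x‖ ≤ 1),
    ENNReal.ofReal (∫ x, u x * divergence φ x)

/-- `u` is an integrable function of bounded variation on Euclidean space. -/
def MemBV {n : ℕ} (u : Euc n → ℝ) : Prop :=
  MemLp u 1 volume ∧ totalVariation u < ⊤

/-- The Jacobian determinant of the map with components `F i`, i.e. the determinant of the matrix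
of partial derivatives. For Lipschitz components it is meaningful almost everywhere. -/
def jacobianDet {n : ℕ} (F : Fin n → Euc n → ℝ) (x : Euc n) : ℝ :=
  Matrix.det (Matrix.of fun i j : Fin n => fderiv ℝ (F i) x (EuclideanSpace.single j 1))

/-- Admissible test tuples `(f, g¹, …, gⁿ⁻¹) = (F 0, F 1, …, F (n-1))`: `f` is Lipschitz with compact
support and its Hölder seminorm of exponent `α` is at most `1`; all `gⁱ` are `1`-Lipschitz. -/
structure IsTestTuple {n : ℕ} [NeZero n] (α : ℝ≥0) (F : Fin n → Euc n → ℝ) : Prop where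
  lipschitz_zero : ∃ L : ℝ≥0, LipschitzWith L (F 0)
  compact_zero : HasCompactSupport (F 0)
  holder_zero : HolderWith 1 α (F 0)
  lipschitz_succ : ∀ i : Fin n, i ≠ 0 → LipschitzWith 1 (F i)

/-- The fractional variation of exponent `α` of `u`. -/
def fracVariation {n : ℕ} [NeZero n] (α : ℝ≥0) (u : Euc n → ℝ) : ℝ≥0∞ :=
  ⨆ (F : Fin n → Euc n → ℝ) (_ : IsTestTuple α F), ‖∫ x, u x * jacobianDet F x‖ₑ

/-- The support of (the almost everywhere class of) `u` is contained in the closed set `K`. -/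
def SupportedIn {n : ℕ} (K : Set (Euc n)) (u : Euc n → ℝ) : Prop :=
  ∀ᵐ x ∂(volume : Measure (Euc n)), x ∉ K → u x = 0

/-- `u` belongs to `L^p` and has compact support (as an almost everywhere class). -/
def MemLpc {n : ℕ} (p : ℝ≥0∞) (u : Euc n → ℝ) : Prop :=
  MemLp u p volume ∧ ∃ K : Set (Euc n), IsCompact K ∧ SupportedIn K u

/-- `u` is a compactly supported integrable function with finite fractional variation of
exponent `α`. -/
def MemBVc {n : ℕ} [NeZero n] (α : ℝ≥0) (u : Euc n → ℝ) : Prop :=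
  MemLpc 1 u ∧ fracVariation α u < ⊤

end FracBV

end

/-!
Both variations are used only through one consequence, `DerivBound α W u`: the integral of `u`
against `∂ᵢf` is at most `W` times the `α`-Hölder constant of the compactly supported `C¹` function
`f`. For the fractional variation this follows by choosing coordinate functions for the `gⁱ`
(`derivBound_of_fracVariation`). For the classical total variation it holds with `α = 0`, since a
compactly supported function is bounded by its oscillation (`derivBound_of_totalVariation`).

Let `ρ_r` be the standard mollifier at scale `r`, and write `s = 1 - α - n (1 - 1 / p)`; the
condition `p < n / (n - 1 + α)` says that `s > 0`. The kernel `ρ_{r/2} - ρ_r` is the divergence of a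
compactly supported `C¹` field, the rescaling of a fixed one (`exists_primitive_of_dilation`). Hence
the convolution of `u` with it is bounded by `C W r ^ (1 - α - n)` pointwise, because translates of
the field are admissible test functions, and by `C W r ^ (1 - α)` in `L¹`, by duality
(`abs_corr_pderiv_le`, `integral_abs_corr_pderiv_le`). Interpolation bounds its `L^p` norm by
`C W r ^ s`, and summing over the scales `r, r / 2, r / 4, …` gives `‖u - u * ρ_r‖_p ≤ C W r ^ s`
(`exists_eLpNorm_sub_corr_moll_le`). Since also `‖u * ρ_r‖_p ≤ C r ^ (-n (1 - 1 / p)) ‖u‖₁`, the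
norm `‖u‖_p` is controlled, with the scale `r` free to be chosen (`exists_eLpNorm_le_of_derivBound`).

For the series, this estimate with `α = 0` is applied to `u_k` at the scale `r = σ ^ (-k)`, where
both terms are of order `V σ ^ (-k s)`. The inclusion of `BV^α_c` in `L^p_c` is the case `r = 1`. For
compactness, a subsequence that converges weakly as measures has pointwise, hence `L^p`, convergent
mollifications at every scale, and the mollifications approximate the functions uniformly in `L^p`
(`exists_subseq_tendsto`).
-/

noncomputable section

namespace FracBV

variable {n : ℕ}

/-! ### Bounds on the distributional gradient -/

/-- The `i`-th partial derivative of `f`. -/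
def pderiv (i : Fin n) (f : Euc n → ℝ) (x : Euc n) : ℝ :=
  fderiv ℝ f x (EuclideanSpace.single i 1)

/-- The distributional gradient of `u`, tested componentwise against compactly supported `C¹`
functions, is bounded by `W` times the Hölder constant of exponent `α` of the test function. -/
def DerivBound (α : ℝ≥0) (W : ℝ) (u : Euc n → ℝ) : Prop :=
  ∀ (i : Fin n) (C : ℝ≥0) (f : Euc n → ℝ), 0 < C → ContDiff ℝ 1 f → HasCompactSupport f →
    HolderWith C α f → |∫ x, u x * pderiv i f x| ≤ C * W

/-- Taking the coordinate functions `xⱼ`, `j ≠ i`, as the components `gⁱ` reduces the Jacobian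
determinant to the partial derivative `∂ᵢf`, up to sign. -/
theorem exists_jacobianDet_eq_pderiv [NeZero n] (i : Fin n) (f : Euc n → ℝ) :
    ∃ s : ℝ, |s| = 1 ∧ ∃ F : Fin n → Euc n → ℝ, F 0 = f ∧
      (∀ j : Fin n, j ≠ 0 → LipschitzWith 1 (F j)) ∧
      ∀ x, jacobianDet F x = s * pderiv i f x := by
  classical
  let τ : Equiv.Perm (Fin n) := Equiv.swap 0 i
  let F : Fin n → Euc n → ℝ := fun j => if j = 0 then f else fun x => x (τ j)
  refine ⟨(Equiv.Perm.sign τ : ℤ), ?_, F, by simp [F], ?_, ?_⟩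
  · rcases Int.units_eq_one_or (Equiv.Perm.sign τ) with h | h <;> simp [h]
  · intro j hj
    simp only [F, if_neg hj]
    refine LipschitzWith.of_dist_le_mul fun x y => ?_
    simpa [dist_eq_norm] using PiLp.norm_apply_le (x - y) (τ j)
  · intro x
    set M := Matrix.of fun a b : Fin n => fderiv ℝ (F a) x (EuclideanSpace.single b 1) with hM
    -- Permuting the columns by `τ` turns all rows but the first into those of the identity matrix.
    have hperm := Matrix.det_permute' τ M
    have hne : ∀ a : Fin n, a ≠ 0 → ∀ b, M a (τ b) = if a = b then 1 else 0 := by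
      intro a ha b
      have h1 : HasFDerivAt (F a) (EuclideanSpace.proj (τ a) : Euc n →L[ℝ] ℝ) x := by
        simp only [F, if_neg ha]
        exact (EuclideanSpace.proj (τ a) : Euc n →L[ℝ] ℝ).hasFDerivAt
      simp [hM, h1.fderiv]
    have htri : (M.submatrix id τ).det = pderiv i f x := by
      rw [Matrix.det_of_isUpperTriangular (M := M.submatrix id τ)]
      · rw [Finset.prod_eq_single (0 : Fin n)]
        · simp [hM, F, τ, pderiv]
        · intro b _ hb
          simp [hne b hb b]
        · simp
      · intro a b hab
        have ha : a ≠ 0 := by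
          rintro rfl
          exact absurd hab (by simp)
        have : a ≠ b := ne_of_gt hab
        simp [hne a ha b, this]
    rw [htri] at hperm
    have hs : ((Equiv.Perm.sign τ : ℤ) : ℝ) * ((Equiv.Perm.sign τ : ℤ) : ℝ) = 1 := by
      rcases Int.units_eq_one_or (Equiv.Perm.sign τ) with h | h <;> simp [h]
    change M.det = _
    rw [hperm, ← mul_assoc, hs, one_mul]

/-- A Hölder function becomes one with constant `1` after division by its constant. -/
theorem holderWith_one_inv_mul {C α : ℝ≥0} (hC : 0 < C) {f : Euc n → ℝ}
    (hf : HolderWith C α f) : HolderWith 1 α fun x => (C : ℝ)⁻¹ * f x := by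
  intro x y
  have h := hf x y
  have h2 : edist ((C : ℝ)⁻¹ * f x) ((C : ℝ)⁻¹ * f y) = (C⁻¹ : ℝ≥0) * edist (f x) (f y) := by
    have := edist_smul₀ ((C : ℝ)⁻¹) (f x) (f y)
    simp only [smul_eq_mul] at this
    rw [this, ENNReal.smul_def, smul_eq_mul]
    congr 2
    ext; simp
  rw [h2]
  calc _ ≤ ((C⁻¹ : ℝ≥0) : ℝ≥0∞) * (C * edist x y ^ (α : ℝ)) := by gcongr
    _ = _ := by
      rw [← mul_assoc, ← ENNReal.coe_mul, inv_mul_cancel₀ hC.ne']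

theorem pderiv_const_mul (i : Fin n) (c : ℝ) {f : Euc n → ℝ} (hf : ContDiff ℝ 1 f) (x : Euc n) :
    pderiv i (fun x => c * f x) x = c * pderiv i f x := by
  have := ((hf.differentiable (by simp) x).hasFDerivAt.const_mul c).fderiv
  simp [pderiv, this]

/-- Finite fractional variation controls the distributional gradient. -/
theorem derivBound_of_fracVariation [NeZero n] {α : ℝ≥0} {u : Euc n → ℝ}
    (hu : fracVariation α u < ⊤) : DerivBound α (fracVariation α u).toReal u := by
  intro i C f hC hf hfc hfα
  set g : Euc n → ℝ := fun x => (C : ℝ)⁻¹ * f x with hg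
  have hgc : HasCompactSupport g := hfc.mul_left
  have hgd : ContDiff ℝ 1 g := contDiff_const.mul hf
  obtain ⟨s, hs, F, hF0, hF, hdet⟩ := exists_jacobianDet_eq_pderiv i g
  have hT : IsTestTuple α F := by
    refine ⟨?_, hF0 ▸ hgc, hF0 ▸ holderWith_one_inv_mul hC hfα, hF⟩
    rw [hF0]
    exact hgd.lipschitzWith_of_hasCompactSupport hgc (by simp)
  have h1 : ‖∫ x, u x * jacobianDet F x‖ₑ ≤ fracVariation α u :=
    le_iSup₂ (f := fun (F : Fin n → Euc n → ℝ) (_ : IsTestTuple α F) =>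
      ‖∫ x, u x * jacobianDet F x‖ₑ) F hT
  have h2 : ∫ x, u x * jacobianDet F x = s * (C : ℝ)⁻¹ * ∫ x, u x * pderiv i f x := by
    rw [← integral_const_mul]
    congr 1 with x
    rw [hdet, pderiv_const_mul i _ hf]
    ring
  rw [h2, Real.enorm_eq_ofReal_abs, ENNReal.ofReal_le_iff_le_toReal hu.ne, abs_mul, abs_mul, hs,
    one_mul, abs_of_nonneg (by positivity), inv_mul_le_iff₀ (by exact_mod_cast hC)] at h1
  exact h1

/-- The classical total variation controls the distributional gradient against bounded test
functions; a compactly supported function is bounded by its oscillation. -/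
theorem derivBound_of_totalVariation [NeZero n] {u : Euc n → ℝ}
    (hu : totalVariation u < ⊤) : DerivBound 0 (totalVariation u).toReal u := by
  intro i C f hC hf hfc hfα
  have hbd : ∀ x, |f x| ≤ C := by
    have : ∃ y, f y = 0 := by
      by_contra! h
      have : IsCompact (Set.univ : Set (Euc n)) := by
        have h3 : tsupport f = Set.univ := by
          rw [← Set.univ_subset_iff]
          exact fun x _ => subset_tsupport f (h x)
        exact h3 ▸ hfc
      exact noncompact_univ (Euc n) this
    obtain ⟨y, hy⟩ := this
    intro x
    have h := hfα x y
    simp only [NNReal.coe_zero, ENNReal.rpow_zero, mul_one, hy] at h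
    rw [edist_nndist] at h
    have h' : nndist (f x) 0 ≤ C := by exact_mod_cast h
    have h'' : dist (f x) 0 ≤ C := by exact_mod_cast h'
    simpa using h''
  have key : ∀ s : ℝ, |s| = 1 → s * ∫ x, u x * pderiv i f x ≤ C * (totalVariation u).toReal := by
    intro s hs
    let φ : Euc n → Euc n := fun x => (s * (C : ℝ)⁻¹ * f x) • EuclideanSpace.single i (1 : ℝ)
    have hφd : ContDiff ℝ 1 φ := (contDiff_const.mul hf).smul contDiff_const
    have hφc : HasCompactSupport φ := by
      have : HasCompactSupport fun x => s * (C : ℝ)⁻¹ * f x := hfc.mul_left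
      exact this.smul_right
    have hφb : ∀ x, ‖φ x‖ ≤ 1 := by
      intro x
      simp only [φ, norm_smul, norm_mul, Real.norm_eq_abs, hs, PiLp.norm_single, abs_one,
        mul_one, one_mul, abs_of_nonneg (inv_nonneg.2 C.coe_nonneg)]
      rw [inv_mul_le_iff₀ (by exact_mod_cast hC), mul_one]
      exact hbd x
    have hdiv : ∀ x, divergence φ x = s * (C : ℝ)⁻¹ * pderiv i f x := by
      intro x
      have h1 : HasFDerivAt φ _ x :=
        ((hf.differentiable (by simp) x).hasFDerivAt.const_mul (s * (C : ℝ)⁻¹)).smul_const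
          (EuclideanSpace.single i (1 : ℝ))
      simp only [divergence, h1.fderiv]
      rw [Finset.sum_eq_single i]
      · simp [pderiv]
      · intro j _ hj
        simp [hj]
      · simp
    have h1 : ENNReal.ofReal (∫ x, u x * divergence φ x) ≤ totalVariation u := by
      unfold totalVariation
      exact le_iSup_of_le φ (le_iSup_of_le hφd (le_iSup_of_le hφc (le_iSup_of_le hφb le_rfl)))
    have h2 : ∫ x, u x * divergence φ x = (C : ℝ)⁻¹ * (s * ∫ x, u x * pderiv i f x) := by
      rw [← integral_const_mul, ← integral_const_mul]
      congr 1 with x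
      rw [hdiv]
      ring
    rw [h2, ENNReal.ofReal_le_iff_le_toReal hu.ne, inv_mul_le_iff₀ (by exact_mod_cast hC)] at h1
    exact h1
  refine abs_le'.2 ⟨by simpa using key 1 (by simp), by simpa using key (-1) (by simp)⟩

/-! ### Differences of mollifiers as divergences -/

/-- The average of the dilates `s ^ (n - 1) * ρ (s x)` over `1 ≤ s ≤ 2`. -/
def dilationAverage (ρ : Euc n → ℝ) (x : Euc n) : ℝ :=
  ∫ s in (1 : ℝ)..2, s ^ (n - 1) * ρ (s • x)

theorem hasFDerivAt_dilationAverage {ρ : Euc n → ℝ} (hρ : ContDiff ℝ 1 ρ)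
    (hc : HasCompactSupport ρ) (x : Euc n) :
    HasFDerivAt (dilationAverage ρ)
      (∫ s in (1 : ℝ)..2, s ^ (n - 1) • (s • fderiv ℝ ρ (s • x))) x := by
  have hcont : Continuous (fderiv ℝ ρ) := hρ.continuous_fderiv (by simp)
  obtain ⟨M, hM⟩ := (hc.fderiv (𝕜 := ℝ)).exists_bound_of_continuous hcont
  have hM0 : 0 ≤ M := (norm_nonneg _).trans (hM 0)
  refine intervalIntegral.hasFDerivAt_integral_of_dominated_of_fderiv_le
    (F := fun x s => s ^ (n - 1) * ρ (s • x)) (s := Set.univ)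
    (F' := fun x s => s ^ (n - 1) • (s • fderiv ℝ ρ (s • x)))
    (bound := fun _ => 2 ^ (n - 1) * (2 * M)) univ_mem ?_ ?_ ?_ ?_ ?_ ?_
  · refine Eventually.of_forall fun y => Continuous.aestronglyMeasurable ?_
    have := hρ.continuous
    fun_prop
  · refine Continuous.intervalIntegrable ?_ _ _
    have := hρ.continuous
    fun_prop
  · refine Continuous.aestronglyMeasurable ?_
    fun_prop
  · refine Eventually.of_forall fun s hs y _ => ?_
    rw [Set.uIoc_of_le (by norm_num)] at hs
    have h0 : 0 ≤ s := by linarith [hs.1]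
    rw [norm_smul, norm_smul, norm_pow, Real.norm_of_nonneg h0]
    gcongr
    · exact hs.2
    · exact hs.2
    · exact hM _
  · exact intervalIntegrable_const
  · refine Eventually.of_forall fun s _ y _ => ?_
    have h1 : HasFDerivAt (fun y : Euc n => s • y) (s • ContinuousLinearMap.id ℝ (Euc n)) y :=
      (hasFDerivAt_id y).const_smul s
    have h2 := ((hρ.differentiable (by simp) (s • y)).hasFDerivAt.comp y h1).const_mul (s ^ (n - 1))
    have h3 : s ^ (n - 1) • (fderiv ℝ ρ (s • y)).comp (s • ContinuousLinearMap.id ℝ (Euc n)) =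
        s ^ (n - 1) • (s • fderiv ℝ ρ (s • y)) := by
      ext v
      simp
    rw [h3] at h2
    exact h2

theorem contDiff_dilationAverage {ρ : Euc n → ℝ} (hρ : ContDiff ℝ 1 ρ)
    (hc : HasCompactSupport ρ) : ContDiff ℝ 1 (dilationAverage ρ) := by
  have hcont : Continuous (fderiv ℝ ρ) := hρ.continuous_fderiv (by simp)
  rw [contDiff_one_iff_hasFDerivAt]
  refine ⟨_, ?_, hasFDerivAt_dilationAverage hρ hc⟩
  exact intervalIntegral.continuous_parametric_intervalIntegral_of_continuous' (by fun_prop) _ _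

theorem hasCompactSupport_dilationAverage {ρ : Euc n → ℝ} (hc : HasCompactSupport ρ) :
    HasCompactSupport (dilationAverage ρ) := by
  obtain ⟨R, hR⟩ := hc.isBounded.subset_closedBall (0 : Euc n)
  refine HasCompactSupport.intro (isCompact_closedBall (0 : Euc n) R) fun x hx => ?_
  have hx' : R < ‖x‖ := by simpa using hx
  refine (intervalIntegral.integral_congr (g := fun _ => (0 : ℝ)) fun s hs => ?_).trans (by simp)
  rw [Set.uIcc_of_le (by norm_num)] at hs
  have : s • x ∉ tsupport ρ := fun h => by
    have h1 := hR h
    rw [mem_closedBall_zero_iff, norm_smul, Real.norm_of_nonneg (by linarith [hs.1])] at h1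
    nlinarith [norm_nonneg x, hs.1]
  simp [image_eq_zero_of_notMem_tsupport this]

/-- Halving the scale of a kernel changes it by a divergence: the vector field `x * G x`, where `G`
is the dilation average, has divergence `2 ^ n * ρ (2 x) - ρ x`, because
`d/ds (s ^ n * ρ (s x))` is the divergence of `x * s ^ (n - 1) * ρ (s x)`. -/
theorem exists_primitive_of_dilation [NeZero n] {ρ : Euc n → ℝ} (hρ : ContDiff ℝ 1 ρ)
    (hc : HasCompactSupport ρ) :
    ∃ Ψ : Fin n → Euc n → ℝ, (∀ i, ContDiff ℝ 1 (Ψ i)) ∧ (∀ i, HasCompactSupport (Ψ i)) ∧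
      ∀ x, 2 ^ n * ρ ((2 : ℝ) • x) - ρ x = ∑ i, pderiv i (Ψ i) x := by
  have hG := contDiff_dilationAverage hρ hc
  have hcont : Continuous (fderiv ℝ ρ) := hρ.continuous_fderiv (by simp)
  refine ⟨fun i x => x i * dilationAverage ρ x, fun i => ?_, fun i => ?_, fun x => ?_⟩
  · exact ((EuclideanSpace.proj i : Euc n →L[ℝ] ℝ).contDiff).mul hG
  · exact (hasCompactSupport_dilationAverage hc).mul_left
  · set G' : Euc n →L[ℝ] ℝ := ∫ s in (1 : ℝ)..2, s ^ (n - 1) • (s • fderiv ℝ ρ (s • x)) with hG'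
    have hp : ∀ i : Fin n, pderiv i (fun x : Euc n => x i * dilationAverage ρ x) x =
        dilationAverage ρ x + x i * G' (EuclideanSpace.single i 1) := by
      intro i
      have h := ((EuclideanSpace.proj i : Euc n →L[ℝ] ℝ).hasFDerivAt (x := x)).mul
        (hasFDerivAt_dilationAverage hρ hc x)
      have h' : fderiv ℝ (fun x : Euc n => x i * dilationAverage ρ x) x = _ := h.fderiv
      rw [pderiv, h']
      simp [← hG']
      ring
    have hsum : ∑ i, x i * G' (EuclideanSpace.single i 1) = G' x := by
      conv_rhs => rw [← (EuclideanSpace.basisFun (Fin n) ℝ).sum_repr x]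
      simp
    have hG'x : G' x = ∫ s in (1 : ℝ)..2, s ^ n * fderiv ℝ ρ (s • x) x := by
      rw [hG', ContinuousLinearMap.intervalIntegral_apply
        (Continuous.intervalIntegrable (by fun_prop) _ _)]
      congr 1 with s
      simp only [smul_apply, smul_eq_mul]
      rw [← mul_assoc, ← pow_succ, Nat.sub_add_cancel NeZero.one_le]
    have hderiv : ∀ s : ℝ, HasDerivAt (fun s : ℝ => s ^ n * ρ (s • x))
        (n * (s ^ (n - 1) * ρ (s • x)) + s ^ n * fderiv ℝ ρ (s • x) x) s := by
      intro s
      have h1 : HasDerivAt (fun s : ℝ => s • x) x s := by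
        simpa using (hasDerivAt_id s).smul_const x
      have h2 := (hρ.differentiable (by simp) (s • x)).hasFDerivAt.comp_hasDerivAt s h1
      have h3 := (hasDerivAt_pow n s).mul h2
      exact h3.congr_deriv (by simp [mul_assoc])
    have hc1 : Continuous fun s : ℝ => s ^ (n - 1) * ρ (s • x) := by
      have := hρ.continuous
      fun_prop
    have hc3 : Continuous fun s : ℝ => (n : ℝ) * (s ^ (n - 1) * ρ (s • x)) :=
      continuous_const.mul hc1
    have hc2 : Continuous fun s : ℝ => s ^ n * fderiv ℝ ρ (s • x) x := by fun_prop
    have hftc := intervalIntegral.integral_eq_sub_of_hasDerivAt (a := 1) (b := 2)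
      (fun s _ => hderiv s) (hc3.add hc2 |>.intervalIntegrable _ _)
    rw [intervalIntegral.integral_add (hc3.intervalIntegrable _ _)
      (hc2.intervalIntegrable _ _), intervalIntegral.integral_const_mul] at hftc
    simp only [hp, Finset.sum_add_distrib, hsum, hG'x]
    simp only [Finset.sum_const, Finset.card_univ, Fintype.card_fin, nsmul_eq_mul]
    rw [dilationAverage, hftc]
    simp

/-! ### Hölder bounds for smooth kernels -/

/-- A quantity that is at most `L d` for `d ≤ 1` and always at most `M` is at most a multiple of
`d ^ α`. -/
theorem le_mul_rpow_of_le_linear_of_le_const {α L M d : ℝ} (hα0 : 0 ≤ α) (hα1 : α ≤ 1) (hL : 0 ≤ L)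
    (hM : 0 ≤ M) (hd : 0 ≤ d) {t : ℝ} (h1 : d ≤ 1 → t ≤ L * d) (h2 : t ≤ M) :
    t ≤ (L + M) * d ^ α := by
  rcases le_total d 1 with h | h
  · rcases hd.eq_or_lt with rfl | hd'
    · have := h1 h
      have : (0 : ℝ) ≤ 0 ^ α := Real.rpow_nonneg le_rfl _
      nlinarith
    · have h3 : d ≤ d ^ α := by
        simpa using Real.rpow_le_rpow_of_exponent_ge hd' h hα1
      have := h1 h
      nlinarith [Real.rpow_nonneg hd α]
  · have h3 : 1 ≤ d ^ α := Real.one_le_rpow h hα0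
    nlinarith

theorem holderWith_of_abs_sub_le {f : Euc n → ℝ} {A α : ℝ≥0}
    (h : ∀ x y, |f x - f y| ≤ A * dist x y ^ (α : ℝ)) : HolderWith A α f := by
  intro x y
  rw [edist_dist, edist_dist, ENNReal.ofReal_rpow_of_nonneg dist_nonneg α.coe_nonneg,
    ← ENNReal.ofReal_coe_nnreal, ← ENNReal.ofReal_mul A.coe_nonneg, Real.dist_eq]
  exact ENNReal.ofReal_le_ofReal (h x y)

/-- A compactly supported `C¹` function is `α`-Hölder both pointwise and in the mean, for every
`α ≤ 1`. -/
theorem exists_holder_bounds {f : Euc n → ℝ} (hf : ContDiff ℝ 1 f) (hc : HasCompactSupport f)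
    {α : ℝ≥0} (hα : α ≤ 1) :
    ∃ A : ℝ, 0 < A ∧ (∀ x y, |f x - f y| ≤ A * dist x y ^ (α : ℝ)) ∧
      ∀ z, ∫ x, |f (x + z) - f x| ≤ A * ‖z‖ ^ (α : ℝ) := by
  obtain ⟨L, hL⟩ := hf.lipschitzWith_of_hasCompactSupport hc (by simp)
  obtain ⟨M, hM⟩ := hc.exists_bound_of_continuous hf.continuous
  have hM0 : 0 ≤ M := (norm_nonneg _).trans (hM 0)
  obtain ⟨R, hR⟩ := hc.isBounded.subset_closedBall (0 : Euc n)
  have hint : Integrable f := hf.continuous.integrable_of_hasCompactSupport hc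
  have hα' : (α : ℝ) ≤ 1 := by exact_mod_cast hα
  set B : ℝ := volume.real (Metric.closedBall (0 : Euc n) (R + 1)) with hB
  have hB0 : 0 ≤ B := measureReal_nonneg
  set I : ℝ := ∫ x, |f x| with hI
  have hI0 : 0 ≤ I := integral_nonneg fun _ => abs_nonneg _
  have hLip : ∀ x y, |f x - f y| ≤ L * dist x y := fun x y => by
    simpa [Real.dist_eq] using hL.dist_le_mul x y
  have hP : ∀ x y, |f x - f y| ≤ (L + 2 * M) * dist x y ^ (α : ℝ) := fun x y =>
    le_mul_rpow_of_le_linear_of_le_const α.coe_nonneg hα' L.coe_nonneg (by positivity) dist_nonneg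
      (fun _ => hLip x y) (by
        have h1 := hM x
        have h2 := hM y
        rw [Real.norm_eq_abs] at h1 h2
        linarith [abs_sub (f x) (f y)])
  have hQ : ∀ z, ∫ x, |f (x + z) - f x| ≤ (L * B + 2 * I) * ‖z‖ ^ (α : ℝ) := by
    intro z
    have hint' : Integrable fun x => f (x + z) := hint.comp_add_right z
    refine le_mul_rpow_of_le_linear_of_le_const α.coe_nonneg hα' (by positivity) (by positivity)
      (norm_nonneg z) (fun hz => ?_) ?_
    · calc ∫ x, |f (x + z) - f x|
          ≤ ∫ x, (Metric.closedBall (0 : Euc n) (R + 1)).indicator (fun _ => L * ‖z‖) x := by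
            refine integral_mono (hint'.sub hint).abs
              ((integrable_indicator_iff measurableSet_closedBall).2
                (integrableOn_const measure_closedBall_lt_top.ne)) fun x => ?_
            by_cases hx : x ∈ Metric.closedBall (0 : Euc n) (R + 1)
            · rw [Set.indicator_of_mem hx]
              simpa [dist_eq_norm] using hLip (x + z) x
            · rw [Set.indicator_of_notMem hx]
              have hx' : R + 1 < ‖x‖ := by simpa using hx
              have h1 : f x = 0 := by
                refine image_eq_zero_of_notMem_tsupport fun h => ?_
                have := mem_closedBall_zero_iff.1 (hR h)
                linarith
              have h2 : f (x + z) = 0 := by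
                refine image_eq_zero_of_notMem_tsupport fun h => ?_
                have := mem_closedBall_zero_iff.1 (hR h)
                have h3 : ‖x‖ ≤ ‖x + z‖ + ‖z‖ := by
                  simpa using norm_sub_le (x + z) z
                linarith
              simp [h1, h2]
        _ = L * B * ‖z‖ := by
            rw [integral_indicator measurableSet_closedBall]
            simp [hB]
            ring
    · calc ∫ x, |f (x + z) - f x| ≤ ∫ x, (|f (x + z)| + |f x|) :=
            integral_mono (hint'.sub hint).abs (hint'.abs.add hint.abs) fun x => abs_sub _ _
        _ = 2 * I := by
            rw [integral_add hint'.abs hint.abs, integral_add_right_eq_self (fun x => |f x|) z]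
            ring
  refine ⟨(L + 2 * M) + (L * B + 2 * I) + 1, by positivity, fun x y => ?_, fun z => ?_⟩
  · refine (hP x y).trans ?_
    refine mul_le_mul_of_nonneg_right ?_ (by positivity)
    nlinarith [mul_nonneg L.coe_nonneg hB0]
  · refine (hQ z).trans ?_
    refine mul_le_mul_of_nonneg_right ?_ (by positivity)
    nlinarith [L.coe_nonneg]

/-! ### Correlation with a smooth kernel -/

/-- The correlation `x ↦ ∫ u y * D (y - x) dy`, that is, the convolution of `u` with the reflection
of the kernel `D`. -/
def corr (u D : Euc n → ℝ) (x : Euc n) : ℝ :=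
  ∫ y, u y * D (y - x)

theorem integrable_mul_kernel {u D : Euc n → ℝ} (hu : Integrable u) (hD : Continuous D)
    (hc : HasCompactSupport D) (x : Euc n) : Integrable fun y => u y * D (y - x) := by
  obtain ⟨M, hM⟩ := hc.exists_bound_of_continuous hD
  exact hu.mul_bdd (c := M) (by fun_prop) (Eventually.of_forall fun y => hM _)

theorem continuous_corr {u D : Euc n → ℝ} (hu : Integrable u) (hD : Continuous D)
    (hc : HasCompactSupport D) : Continuous (corr u D) := by
  obtain ⟨M, hM⟩ := hc.exists_bound_of_continuous hD
  refine continuous_of_dominated (bound := fun y => ‖u y‖ * M)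
    (fun x => (integrable_mul_kernel hu hD hc x).aestronglyMeasurable)
    (fun x => Eventually.of_forall fun y => ?_) (hu.norm.mul_const M)
    (Eventually.of_forall fun y => by fun_prop)
  rw [norm_mul]
  gcongr
  exact hM _

theorem abs_corr_le {u D : Euc n → ℝ} {M : ℝ} (hu : Integrable u) (hM : ∀ x, |D x| ≤ M)
    (x : Euc n) : |corr u D x| ≤ M * ∫ y, |u y| := by
  rw [← integral_const_mul]
  refine norm_integral_le_of_norm_le (f := fun y => u y * D (y - x)) (hu.abs.const_mul M)
    (Eventually.of_forall fun y => ?_)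
  rw [norm_mul, mul_comm, Real.norm_eq_abs, Real.norm_eq_abs]
  gcongr
  exact hM _

theorem corr_sub {u D E : Euc n → ℝ} (hu : Integrable u) (hD : Continuous D)
    (hDc : HasCompactSupport D) (hE : Continuous E) (hEc : HasCompactSupport E) (x : Euc n) :
    corr u (fun y => D y - E y) x = corr u D x - corr u E x := by
  simp only [corr, mul_sub]
  exact integral_sub (integrable_mul_kernel hu hD hDc x) (integrable_mul_kernel hu hE hEc x)

theorem corr_finset_sum {ι : Type*} (s : Finset ι) {u : Euc n → ℝ} {D : ι → Euc n → ℝ}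
    (hu : Integrable u) (hD : ∀ i, Continuous (D i)) (hc : ∀ i, HasCompactSupport (D i))
    (x : Euc n) : corr u (fun y => ∑ i ∈ s, D i y) x = ∑ i ∈ s, corr u (D i) x := by
  simp only [corr, Finset.mul_sum]
  exact integral_finsetSum s fun i _ => integrable_mul_kernel hu (hD i) (hc i) x

/-- Fubini's theorem moves a correlation onto the test function. -/
theorem integral_mul_corr {u D h : Euc n → ℝ} (hu : Integrable u) (hD : Continuous D)
    (hc : HasCompactSupport D) (hh : Integrable h) :
    ∫ x, h x * corr u D x = ∫ y, u y * ∫ x, h x * D (y - x) := by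
  obtain ⟨M, hM⟩ := hc.exists_bound_of_continuous hD
  have hint : Integrable (Function.uncurry fun x y : Euc n => h x * (u y * D (y - x)))
      (volume.prod volume) := by
    have h1 : Integrable (fun z : Euc n × Euc n => (h z.1 * u z.2) * D (z.2 - z.1))
        (volume.prod volume) :=
      (hh.mul_prod hu).mul_bdd (c := M)
        (Continuous.aestronglyMeasurable (by fun_prop)) (Eventually.of_forall fun z => hM _)
    refine h1.congr (Eventually.of_forall fun z => ?_)
    simp [Function.uncurry, mul_assoc]
  simp only [corr, ← integral_const_mul]
  rw [integral_integral_swap hint]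
  congr 1 with y
  congr 1 with x
  ring

/-- The `L¹` norm of a continuous function is detected by bounded, compactly supported test
functions: its truncated sign attains the norm on large balls. -/
theorem integrable_of_forall_test {w : Euc n → ℝ} (hw : Continuous w) {b : ℝ}
    (h : ∀ φ : Euc n → ℝ, Measurable φ → (∀ x, |φ x| ≤ 1) → HasCompactSupport φ →
      ∫ x, φ x * w x ≤ b) :
    Integrable w ∧ ∫ x, |w x| ≤ b := by
  have hcov : AECover (volume : Measure (Euc n)) atTop
      fun k : ℕ => Metric.closedBall (0 : Euc n) (k : ℝ) :=
    aecover_closedBall tendsto_natCast_atTop_atTop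
  have hball : ∀ k : ℕ, ∫ x in Metric.closedBall (0 : Euc n) (k : ℝ), ‖w x‖ ≤ b := by
    intro k
    let φ : Euc n → ℝ := (Metric.closedBall (0 : Euc n) (k : ℝ)).indicator
      fun x => if 0 ≤ w x then 1 else -1
    have hφ : Measurable φ :=
      (Measurable.ite (measurableSet_le measurable_const hw.measurable)
        measurable_const measurable_const).indicator measurableSet_closedBall
    have h1 : ∀ x, |φ x| ≤ 1 := by
      intro x
      by_cases hx : x ∈ Metric.closedBall (0 : Euc n) (k : ℝ)
      · simp only [φ, Set.indicator_of_mem hx]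
        split_ifs <;> simp
      · simp [φ, Set.indicator_of_notMem hx]
    have h2 : HasCompactSupport φ :=
      HasCompactSupport.intro (isCompact_closedBall (0 : Euc n) k) fun x hx =>
        Set.indicator_of_notMem hx _
    refine le_trans (le_of_eq ?_) (h φ hφ h1 h2)
    rw [← integral_indicator measurableSet_closedBall]
    congr 1 with x
    by_cases hx : x ∈ Metric.closedBall (0 : Euc n) (k : ℝ)
    · simp only [φ, Set.indicator_of_mem hx, Real.norm_eq_abs]
      split_ifs with h0
      · rw [abs_of_nonneg h0, one_mul]
      · rw [abs_of_neg (not_le.1 h0), neg_one_mul]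
    · simp [φ, Set.indicator_of_notMem hx]
  have hwi : Integrable w := hcov.integrable_of_integral_norm_bounded b
    (fun k => hw.continuousOn.integrableOn_compact (isCompact_closedBall _ _))
    (Eventually.of_forall hball)
  exact ⟨hwi, le_of_tendsto (hcov.integral_tendsto_of_countably_generated hwi.norm)
    (Eventually.of_forall hball)⟩

theorem integrable_of_bounded_test {φ : Euc n → ℝ} (hφ : Measurable φ) (h1 : ∀ x, |φ x| ≤ 1)
    (hc : HasCompactSupport φ) : Integrable φ := by
  rw [← integrableOn_iff_integrable_of_support_subset (subset_tsupport φ)]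
  exact Measure.integrableOn_of_bounded (M := 1) hc.measure_lt_top.ne hφ.aestronglyMeasurable
    (Eventually.of_forall h1)

theorem corr_integral_bound {u D : Euc n → ℝ} (hu : Integrable u) (hD : Continuous D)
    (hc : HasCompactSupport D) :
    Integrable (corr u D) ∧ ∫ x, |corr u D x| ≤ (∫ x, |D x|) * ∫ y, |u y| := by
  have hDi : Integrable D := hD.integrable_of_hasCompactSupport hc
  refine integrable_of_forall_test (continuous_corr hu hD hc) fun φ hφ h1 hφc => ?_
  rw [integral_mul_corr hu hD hc (integrable_of_bounded_test hφ h1 hφc), ← integral_const_mul]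
  refine (le_abs_self _).trans <|
    norm_integral_le_of_norm_le (f := fun y => u y * ∫ x, φ x * D (y - x)) (hu.abs.const_mul _)
    (Eventually.of_forall fun y => ?_)
  rw [norm_mul, mul_comm, Real.norm_eq_abs, Real.norm_eq_abs]
  gcongr
  rw [← integral_sub_left_eq_self (fun x => |D x|) volume y]
  refine norm_integral_le_of_norm_le (f := fun x => φ x * D (y - x)) (hDi.comp_sub_left y).abs
    (Eventually.of_forall fun x => ?_)
  rw [norm_mul]
  exact mul_le_of_le_one_left (abs_nonneg _) (h1 x)

/-! ### Derivative kernels -/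

theorem DerivBound.abs_integral_le {α : ℝ≥0} {W : ℝ} {u : Euc n → ℝ} (hW : DerivBound α W u)
    (i : Fin n) {f : Euc n → ℝ} (hf : ContDiff ℝ 1 f) (hc : HasCompactSupport f) {A : ℝ}
    (hA : 0 < A) (h : ∀ x y, |f x - f y| ≤ A * dist x y ^ (α : ℝ)) :
    |∫ x, u x * pderiv i f x| ≤ A * W := by
  lift A to ℝ≥0 using hA.le
  exact hW i A f (by exact_mod_cast hA) hf hc (holderWith_of_abs_sub_le h)

theorem continuous_pderiv (i : Fin n) {f : Euc n → ℝ} (hf : ContDiff ℝ 1 f) :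
    Continuous (pderiv i f) := by
  have := hf.continuous_fderiv (by simp)
  unfold pderiv
  fun_prop

theorem hasCompactSupport_pderiv (i : Fin n) {f : Euc n → ℝ} (hc : HasCompactSupport f) :
    HasCompactSupport (pderiv i f) :=
  hc.fderiv_apply ℝ _

/-- The correlation with `∂ᵢf` is bounded, since the translates of `f` are admissible test
functions. -/
theorem abs_corr_pderiv_le {α : ℝ≥0} {W : ℝ} {u : Euc n → ℝ} (hW : DerivBound α W u)
    (i : Fin n) {f : Euc n → ℝ} (hf : ContDiff ℝ 1 f) (hc : HasCompactSupport f) {A : ℝ}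
    (hA : 0 < A) (h : ∀ x y, |f x - f y| ≤ A * dist x y ^ (α : ℝ)) (x : Euc n) :
    |corr u (pderiv i f) x| ≤ A * W := by
  have h1 : ∀ y, pderiv i f (y - x) = pderiv i (fun y => f (y - x)) y := fun y => by
    simp only [pderiv, fderiv_comp_sub]
  simp only [corr, h1]
  refine hW.abs_integral_le i (hf.comp (contDiff_id.sub contDiff_const))
    (hc.comp_homeomorph (Homeomorph.subRight x)) hA fun y z => ?_
  simpa using h (y - x) (z - x)

/-- The average of translates `∫ φ x * f (y - x) dx` of a compactly supported `C¹` function `f` is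
again compactly supported and `C¹`, and may be differentiated under the integral. -/
theorem convolution_test {φ f : Euc n → ℝ} (hφ : Integrable φ) (hφc : HasCompactSupport φ)
    (hf : ContDiff ℝ 1 f) (hc : HasCompactSupport f) :
    ContDiff ℝ 1 (fun y => ∫ x, φ x * f (y - x)) ∧
      HasCompactSupport (fun y => ∫ x, φ x * f (y - x)) ∧
      ∀ i y, pderiv i (fun y => ∫ x, φ x * f (y - x)) y = ∫ x, φ x * pderiv i f (y - x) := by
  have hg : (fun y => ∫ x, φ x * f (y - x)) =
      convolution φ f (ContinuousLinearMap.lsmul ℝ ℝ) volume := rfl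
  rw [hg]
  refine ⟨hc.contDiff_convolution_right (n := 1) _ hφ.locallyIntegrable (by exact_mod_cast hf),
    hφc.convolution _ hc, fun i y => ?_⟩
  have h2 := hc.hasFDerivAt_convolution_right (ContinuousLinearMap.lsmul ℝ ℝ)
    hφ.locallyIntegrable hf y
  rw [pderiv, h2.fderiv]
  exact convolution_precompR_apply (ContinuousLinearMap.lsmul ℝ ℝ)
    hφ.locallyIntegrable (hc.fderiv ℝ) (hf.continuous_fderiv (by simp)) _ _

/-- The correlation with `∂ᵢf` is bounded in `L¹`: integrated against a test function `φ` with
values in `[-1, 1]` it equals the integral of `u` against `∂ᵢ(φ ⋆ f)`, and `φ ⋆ f` is Hölder because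
`f` is Hölder in the mean. -/
theorem integral_abs_corr_pderiv_le {α : ℝ≥0} {W : ℝ} {u : Euc n → ℝ} (hu : Integrable u)
    (hW : DerivBound α W u) (i : Fin n) {f : Euc n → ℝ} (hf : ContDiff ℝ 1 f)
    (hc : HasCompactSupport f) {A : ℝ} (hA : 0 < A)
    (h : ∀ z, ∫ x, |f (x + z) - f x| ≤ A * ‖z‖ ^ (α : ℝ)) :
    Integrable (corr u (pderiv i f)) ∧ ∫ x, |corr u (pderiv i f) x| ≤ A * W := by
  have hD := continuous_pderiv i hf
  have hDc := hasCompactSupport_pderiv i hc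
  have hfi : Integrable f := hf.continuous.integrable_of_hasCompactSupport hc
  refine integrable_of_forall_test (continuous_corr hu hD hDc) fun φ hφ h1 hφc => ?_
  have hφi := integrable_of_bounded_test hφ h1 hφc
  rw [integral_mul_corr hu hD hDc hφi]
  obtain ⟨hgd, hgc, hgp⟩ := convolution_test hφi hφc hf hc
  simp only [← hgp]
  refine (le_abs_self _).trans (hW.abs_integral_le i hgd hgc hA fun y z => ?_)
  have hint : ∀ y, Integrable fun x => φ x * f (y - x) := fun y =>
    (hfi.comp_sub_left y).bdd_mul (c := 1) hφ.aestronglyMeasurable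
      (Eventually.of_forall h1)
  rw [← integral_sub (hint y) (hint z)]
  have h3 : |∫ x, (φ x * f (y - x) - φ x * f (z - x))| ≤ ∫ x, |f (y - x) - f (z - x)| := by
    refine norm_integral_le_of_norm_le (f := fun x => φ x * f (y - x) - φ x * f (z - x))
      ((hfi.comp_sub_left y).sub (hfi.comp_sub_left z)).abs (Eventually.of_forall fun x => ?_)
    rw [← mul_sub, norm_mul]
    exact mul_le_of_le_one_left (abs_nonneg _) (h1 x)
  refine h3.trans ?_
  have h4 := integral_sub_left_eq_self (fun x => |f (x + (y - z)) - f x|) volume z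
  have h5 : ∀ x, z - x + (y - z) = y - x := fun x => by abel
  simp only [h5] at h4
  rw [h4, dist_eq_norm]
  exact h (y - z)

/-! ### Interpolation -/

/-- A function with `|w| ≤ c * r ^ (e - n)` and `‖w‖₁ ≤ c * r ^ e` has `L^p` norm at most
`c * r ^ (e - n (1 - 1 / p))`. -/
theorem eLpNorm_le_of_sup_of_integral {p : ℝ≥0∞} (hp : 1 ≤ p) (hp' : p ≠ ⊤) {w : Euc n → ℝ}
    {c r e : ℝ} (hc : 0 ≤ c) (hr : 0 < r) (hw : Integrable w)
    (hsup : ∀ x, |w x| ≤ c * r ^ (e - n)) (hint : ∫ x, |w x| ≤ c * r ^ e) :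
    eLpNorm w p volume ≤ ENNReal.ofReal (c * r ^ (e - n * (1 - 1 / p.toReal))) := by
  set q := p.toReal with hq
  have hq1 : 1 ≤ q := by
    have := ENNReal.toReal_mono hp' hp
    simpa using this
  have hq0 : 0 < q := by linarith
  have ha : 0 ≤ c * r ^ (e - n) := by positivity
  have hb : 0 ≤ c * r ^ e := by positivity
  rw [eLpNorm_eq_lintegral_rpow_enorm_toReal (by positivity) hp', ← hq]
  have h1 : ∫⁻ x, ‖w x‖ₑ ^ q ≤
      ENNReal.ofReal ((c * r ^ (e - n)) ^ (q - 1)) * ENNReal.ofReal (c * r ^ e) := by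
    calc ∫⁻ x, ‖w x‖ₑ ^ q
        ≤ ∫⁻ x, ENNReal.ofReal ((c * r ^ (e - n)) ^ (q - 1)) * ‖w x‖ₑ := by
          refine lintegral_mono fun x => ?_
          have h2 : ‖w x‖ₑ ^ q = ‖w x‖ₑ ^ (q - 1) * ‖w x‖ₑ := by
            conv_rhs => rw [← ENNReal.rpow_one ‖w x‖ₑ, ← ENNReal.rpow_mul, one_mul]
            rw [← ENNReal.rpow_add_of_nonneg _ _ (by linarith) zero_le_one, sub_add_cancel]
          rw [h2]
          gcongr
          rw [← ENNReal.ofReal_rpow_of_nonneg ha (by linarith), Real.enorm_eq_ofReal_abs]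
          gcongr
          exact hsup x
      _ = ENNReal.ofReal ((c * r ^ (e - n)) ^ (q - 1)) * ∫⁻ x, ‖w x‖ₑ :=
          lintegral_const_mul' _ _ ENNReal.ofReal_ne_top
      _ ≤ _ := by
          gcongr
          rw [← ofReal_integral_norm_eq_lintegral_enorm hw]
          exact ENNReal.ofReal_le_ofReal hint
  rw [← ENNReal.ofReal_mul (by positivity)] at h1
  refine (ENNReal.rpow_le_rpow h1 (by positivity)).trans (le_of_eq ?_)
  rw [ENNReal.ofReal_rpow_of_nonneg (by positivity) (by positivity)]
  congr 1
  rcases hc.eq_or_lt with rfl | hc'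
  · simp only [zero_mul, mul_zero]
    exact Real.zero_rpow (by positivity)
  · rw [Real.mul_rpow hc (by positivity), mul_mul_mul_comm, ← Real.rpow_add_one hc'.ne',
      ← Real.rpow_mul hr.le, ← Real.rpow_add hr, Real.mul_rpow (by positivity) (by positivity),
      ← Real.rpow_mul hc, ← Real.rpow_mul hr.le]
    congr 1
    · rw [sub_add_cancel, mul_one_div_cancel hq0.ne', Real.rpow_one]
    · congr 1
      field_simp
      ring

/-! ### Mollification at a given scale -/

/-- The bump function that is `1` on the ball of radius `r` and vanishes outside radius `2 r`. -/
def bump (n : ℕ) (r : ℝ) (hr : 0 < r) : ContDiffBump (0 : Euc n) where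
  rIn := r
  rOut := 2 * r
  rIn_pos := hr
  rIn_lt_rOut := by linarith

/-- The standard mollifier at scale `r`: the rescaling `r ^ (-n) * ρ (x / r)` of a fixed smooth
bump `ρ` of integral one. -/
def moll (r : ℝ) (x : Euc n) : ℝ :=
  r⁻¹ ^ n * (bump n 1 one_pos).normed volume (r⁻¹ • x)

theorem moll_eq_normed {r : ℝ} (hr : 0 < r) (x : Euc n) :
    moll r x = (bump n r hr).normed volume x := by
  have h : ∀ y : Euc n, bump n r hr y = bump n 1 one_pos (r⁻¹ • y) := fun y => by
    have : 2 * r / r = 2 * 1 / 1 := by field_simp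
    simp only [ContDiffBump.apply, bump, sub_zero, inv_one, one_smul, this]
  simp only [moll, ContDiffBump.normed_def, h]
  rw [Measure.integral_comp_inv_smul_of_nonneg volume (fun y => bump n 1 one_pos y) hr.le]
  simp only [finrank_euclideanSpace, Fintype.card_fin, smul_eq_mul]
  rw [mul_comm (r ^ n), ← div_div, div_eq_mul_inv _ (r ^ n), inv_pow, mul_comm]

theorem contDiff_moll (r : ℝ) : ContDiff ℝ 1 (moll r : Euc n → ℝ) := by
  have h : ContDiff ℝ 1 ((bump n 1 one_pos).normed volume) :=
    ContDiffBump.contDiff_normed (n := 1) _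
  exact contDiff_const.mul (h.comp (contDiff_const_smul _))

theorem hasCompactSupport_moll {r : ℝ} (hr : 0 < r) : HasCompactSupport (moll r : Euc n → ℝ) := by
  rw [funext (moll_eq_normed hr)]
  exact ContDiffBump.hasCompactSupport_normed _

theorem integral_abs_moll {r : ℝ} (hr : 0 < r) : ∫ x : Euc n, |moll r x| = 1 := by
  simp only [moll_eq_normed hr, abs_of_nonneg (ContDiffBump.nonneg_normed _ _)]
  exact ContDiffBump.integral_normed _

theorem exists_moll_le (n : ℕ) :
    ∃ M : ℝ, 0 ≤ M ∧ ∀ r : ℝ, 0 < r → ∀ x : Euc n, |moll r x| ≤ M * r ^ (-(n : ℝ)) := by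
  obtain ⟨M, hM⟩ := (ContDiffBump.hasCompactSupport_normed (μ := volume)
    (bump n 1 one_pos)).exists_bound_of_continuous (ContDiffBump.continuous_normed _)
  refine ⟨M, (norm_nonneg _).trans (hM 0), fun r hr x => ?_⟩
  rw [moll, abs_mul, mul_comm, Real.rpow_neg hr.le, Real.rpow_natCast, inv_pow,
    abs_of_nonneg (by positivity : 0 ≤ (r ^ n)⁻¹)]
  gcongr
  exact hM _

theorem ae_tendsto_corr_moll {u : Euc n → ℝ} (hu : Integrable u) {r : ℕ → ℝ}
    (hr : ∀ k, 0 < r k) (hr0 : Tendsto r atTop (𝓝 0)) :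
    ∀ᵐ x, Tendsto (fun k => corr u (moll (r k)) x) atTop (𝓝 (u x)) := by
  have h := ContDiffBump.ae_convolution_tendsto_right_of_locallyIntegrable (μ := volume)
    (φ := fun k => bump n (r k) (hr k)) (l := atTop) (K := 2) (g := u)
    (by simpa [bump] using hr0.const_mul 2)
    (Eventually.of_forall fun k => le_of_eq (by simp [bump])) hu.locallyIntegrable
  filter_upwards [h] with x hx
  refine hx.congr fun k => ?_
  rw [convolution_lsmul_swap]
  refine integral_congr_ae (Eventually.of_forall fun y => ?_)
  simp only [smul_eq_mul, moll_eq_normed (hr k)]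
  rw [mul_comm, ← neg_sub, ContDiffBump.normed_neg]

/-- The Hölder bounds of a kernel under rescaling. -/
theorem rescaled_holder_bounds {f : Euc n → ℝ} {A α r : ℝ} (hr : 0 < r)
    (h1 : ∀ x y, |f x - f y| ≤ A * dist x y ^ α)
    (h2 : ∀ z, ∫ x, |f (x + z) - f x| ≤ A * ‖z‖ ^ α) :
    (∀ x y, |r * r⁻¹ ^ n * f (r⁻¹ • x) - r * r⁻¹ ^ n * f (r⁻¹ • y)| ≤
      A * r ^ (1 - α - n) * dist x y ^ α) ∧
    ∀ z, ∫ x, |r * r⁻¹ ^ n * f (r⁻¹ • (x + z)) - r * r⁻¹ ^ n * f (r⁻¹ • x)| ≤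
      A * r ^ (1 - α) * ‖z‖ ^ α := by
  have hr' : 0 ≤ r⁻¹ := by positivity
  have hpos : 0 ≤ r * r⁻¹ ^ n := by positivity
  have e1 : r ^ (1 - α) = r * r⁻¹ ^ α := by
    rw [Real.rpow_sub hr, Real.rpow_one, Real.inv_rpow hr.le, div_eq_mul_inv]
  have e2 : r ^ (1 - α - n) = r * r⁻¹ ^ n * r⁻¹ ^ α := by
    rw [Real.rpow_sub hr, e1, Real.rpow_natCast, div_eq_mul_inv, inv_pow]
    ring
  constructor
  · intro x y
    rw [← mul_sub, abs_mul, abs_of_nonneg hpos, e2]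
    calc _ ≤ r * r⁻¹ ^ n * (A * dist (r⁻¹ • x) (r⁻¹ • y) ^ α) := by
          gcongr
          exact h1 _ _
      _ = _ := by
          rw [dist_smul₀, Real.norm_of_nonneg hr', Real.mul_rpow hr' dist_nonneg]
          ring
  · intro z
    simp only [← mul_sub, abs_mul, abs_of_nonneg hpos, smul_add]
    rw [integral_const_mul, Measure.integral_comp_inv_smul_of_nonneg volume
      (fun x => |f (x + r⁻¹ • z) - f x|) hr.le, finrank_euclideanSpace, Fintype.card_fin,
      smul_eq_mul, e1]
    have h3 := h2 (r⁻¹ • z)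
    rw [norm_smul, Real.norm_of_nonneg hr', Real.mul_rpow hr' (norm_nonneg _)] at h3
    calc _ = r * ∫ x, |f (x + r⁻¹ • z) - f x| := by
          rw [mul_assoc, ← mul_assoc (r⁻¹ ^ n), ← mul_pow, inv_mul_cancel₀ hr.ne', one_pow, one_mul]
      _ ≤ r * (A * (r⁻¹ ^ α * ‖z‖ ^ α)) := by gcongr
      _ = _ := by ring

theorem pderiv_rescaled (i : Fin n) {f : Euc n → ℝ} (hf : ContDiff ℝ 1 f) {r : ℝ} (hr : 0 < r)
    (x : Euc n) : pderiv i (fun x => r * r⁻¹ ^ n * f (r⁻¹ • x)) x =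
      r⁻¹ ^ n * pderiv i f (r⁻¹ • x) := by
  rw [pderiv_const_mul i _ (f := fun x => f (r⁻¹ • x)) (hf.comp (contDiff_const_smul _)), pderiv, pderiv,
    fderiv_comp_smul]
  simp only [smul_apply, smul_eq_mul]
  field_simp

/-- Two consecutive mollifications differ by little: the difference of the kernels is a divergence,
so that it is controlled by the bound on the distributional gradient of `u`. -/
theorem exists_eLpNorm_corr_moll_half_sub_le [NeZero n] {α : ℝ≥0} (hα : α ≤ 1) {p : ℝ≥0∞}
    (hp : 1 ≤ p) (hp' : p ≠ ⊤) :
    ∃ K : ℝ, 0 ≤ K ∧ ∀ (u : Euc n → ℝ) (W r : ℝ), Integrable u → 0 ≤ W → DerivBound α W u →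
      0 < r → eLpNorm (fun x => corr u (moll (r / 2)) x - corr u (moll r) x) p volume ≤
        ENNReal.ofReal (K * W * r ^ (1 - (α : ℝ) - n * (1 - 1 / p.toReal))) := by
  obtain ⟨Ψ, hΨ, hΨc, hdiv⟩ := exists_primitive_of_dilation (contDiff_moll (n := n) 1)
    (hasCompactSupport_moll one_pos)
  choose A hA hA1 hA2 using fun i => exists_holder_bounds (hΨ i) (hΨc i) hα
  refine ⟨∑ i, A i, Finset.sum_nonneg fun i _ => (hA i).le, fun u W r hu hW hDW hr => ?_⟩
  let ψ : Fin n → Euc n → ℝ := fun i x => r * r⁻¹ ^ n * Ψ i (r⁻¹ • x)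
  have hψ : ∀ i, ContDiff ℝ 1 (ψ i) := fun i =>
    contDiff_const.mul ((hΨ i).comp (contDiff_const_smul _))
  have hψc : ∀ i, HasCompactSupport (ψ i) := fun i =>
    ((hΨc i).comp_smul (inv_ne_zero hr.ne')).mul_left
  have hsplit : ∀ x : Euc n, moll (r / 2) x - moll r x = ∑ i, pderiv i (ψ i) x := by
    intro x
    have h1 := hdiv (r⁻¹ • x)
    simp only [ψ, pderiv_rescaled _ (hΨ _) hr, ← Finset.mul_sum, ← h1]
    simp only [moll, inv_one, one_pow, one_mul, inv_div, smul_smul, mul_sub]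
    rw [div_eq_mul_inv, mul_pow]
    ring
  have hcorr : (fun x => corr u (moll (r / 2)) x - corr u (moll r) x) =
      ∑ i, corr u (pderiv i (ψ i)) := by
    ext x
    rw [Finset.sum_apply, ← corr_finset_sum _ hu (fun i => continuous_pderiv i (hψ i))
      (fun i => hasCompactSupport_pderiv i (hψc i)),
      ← corr_sub hu (contDiff_moll _).continuous (hasCompactSupport_moll (by positivity))
        (contDiff_moll _).continuous (hasCompactSupport_moll hr)]
    simp only [hsplit]
  have hbound : ∀ i, eLpNorm (corr u (pderiv i (ψ i))) p volume ≤
      ENNReal.ofReal (A i * W * r ^ (1 - (α : ℝ) - n * (1 - 1 / p.toReal))) := by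
    intro i
    obtain ⟨h1, h2⟩ := rescaled_holder_bounds hr (hA1 i) (hA2 i)
    have h3 := integral_abs_corr_pderiv_le hu hDW i (hψ i) (hψc i)
      (mul_pos (hA i) (Real.rpow_pos_of_pos hr _)) h2
    have h4 := abs_corr_pderiv_le hDW i (hψ i) (hψc i)
      (mul_pos (hA i) (Real.rpow_pos_of_pos hr _)) h1
    refine eLpNorm_le_of_sup_of_integral hp hp' (mul_nonneg (hA i).le hW) hr h3.1
      (fun x => (h4 x).trans (le_of_eq (by ring))) (h3.2.trans (le_of_eq (by ring)))
  rw [hcorr]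
  refine (eLpNorm_sum_le (fun i _ => (continuous_corr hu (continuous_pderiv i (hψ i))
    (hasCompactSupport_pderiv i (hψc i))).aestronglyMeasurable) hp).trans ?_
  refine (Finset.sum_le_sum fun i _ => hbound i).trans (le_of_eq ?_)
  rw [← ENNReal.ofReal_sum_of_nonneg fun i _ => by have := hA i; positivity]
  simp only [Finset.sum_mul]

theorem eLpNorm_le_of_ae_tendsto {X : Type*} [MeasurableSpace X] {μ : Measure X} {p B : ℝ≥0∞}
    {f : ℕ → X → ℝ} {g : X → ℝ} (hf : ∀ k, AEStronglyMeasurable (f k) μ)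
    (hB : ∀ k, eLpNorm (f k) p μ ≤ B)
    (h : ∀ᵐ x ∂μ, Tendsto (fun k => f k x) atTop (𝓝 (g x))) : eLpNorm g p μ ≤ B := by
  refine (Lp.eLpNorm_lim_le_liminf_eLpNorm hf g h).trans ?_
  refine (liminf_le_liminf (Eventually.of_forall hB)).trans ?_
  simp

/-- The rate at which mollifications converge in `L^p`, by summing a geometric series over the
scales `r, r / 2, r / 4, …`. -/
theorem exists_eLpNorm_sub_corr_moll_le [NeZero n] {α : ℝ≥0} (hα : α ≤ 1) {p : ℝ≥0∞}
    (hp : 1 ≤ p) (hp' : p ≠ ⊤) (hs : 0 < 1 - (α : ℝ) - n * (1 - 1 / p.toReal)) :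
    ∃ K : ℝ, 0 ≤ K ∧ ∀ (u : Euc n → ℝ) (W r : ℝ), Integrable u → 0 ≤ W → DerivBound α W u →
      0 < r → eLpNorm (fun x => u x - corr u (moll r) x) p volume ≤
        ENNReal.ofReal (K * W * r ^ (1 - (α : ℝ) - n * (1 - 1 / p.toReal))) := by
  obtain ⟨K, hK, hKb⟩ := exists_eLpNorm_corr_moll_half_sub_le (n := n) hα hp hp'
  set s : ℝ := 1 - (α : ℝ) - n * (1 - 1 / p.toReal) with hsdef
  set q : ℝ := ((2 : ℝ) ^ s)⁻¹ with hq
  have hq0 : 0 ≤ q := by positivity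
  have hq1 : q < 1 := inv_lt_one_of_one_lt₀ (Real.one_lt_rpow one_lt_two hs)
  refine ⟨K * (1 - q)⁻¹, mul_nonneg hK (inv_nonneg.2 (by linarith)),
    fun u W r hu hW hDW hr => ?_⟩
  have hrk : ∀ k : ℕ, 0 < r / 2 ^ k := fun k => by positivity
  have hcont : ∀ k : ℕ, Continuous (corr u (moll (r / 2 ^ k))) := fun k =>
    continuous_corr hu (contDiff_moll _).continuous (hasCompactSupport_moll (hrk k))
  have hcont0 : Continuous (corr u (moll r)) := by simpa using hcont 0
  have hlim : Tendsto (fun k : ℕ => r / 2 ^ k) atTop (𝓝 0) :=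
    tendsto_const_nhds.div_atTop (tendsto_pow_atTop_atTop_of_one_lt one_lt_two)
  refine eLpNorm_le_of_ae_tendsto
    (f := fun k x => corr u (moll (r / 2 ^ k)) x - corr u (moll r) x)
    (fun k => ((hcont k).sub hcont0).aestronglyMeasurable) (fun k => ?_) ?_
  · have htel : (fun x => corr u (moll (r / 2 ^ k)) x - corr u (moll r) x) =
        ∑ j ∈ Finset.range k,
          fun x => corr u (moll (r / 2 ^ j / 2)) x - corr u (moll (r / 2 ^ j)) x := by
      ext x
      rw [Finset.sum_apply]
      have := Finset.sum_range_sub (fun j => corr u (moll (r / 2 ^ j)) x) k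
      simp only [pow_zero, div_one, pow_succ, ← div_div] at this
      exact this.symm
    rw [htel]
    refine (eLpNorm_sum_le (fun j _ => ?_) hp).trans ?_
    · have := hcont (j + 1)
      rw [pow_succ, ← div_div] at this
      exact (this.sub (hcont j)).aestronglyMeasurable
    · have hterm : ∀ j : ℕ, K * W * (r / 2 ^ j) ^ s = K * W * r ^ s * q ^ j := by
        intro j
        rw [Real.div_rpow hr.le (by positivity), hq, inv_pow, ← Real.rpow_natCast (2 ^ s),
          ← Real.rpow_mul zero_le_two, mul_comm s, Real.rpow_mul zero_le_two, Real.rpow_natCast]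
        ring
      refine (Finset.sum_le_sum fun j _ => hKb u W _ hu hW hDW (hrk j)).trans ?_
      rw [← ENNReal.ofReal_sum_of_nonneg fun j _ => by positivity]
      refine ENNReal.ofReal_le_ofReal ?_
      simp only [hterm, ← Finset.mul_sum]
      have hgeo : ∑ j ∈ Finset.range k, q ^ j ≤ (1 - q)⁻¹ := by
        rw [← tsum_geometric_of_lt_one hq0 hq1]
        exact (summable_geometric_of_lt_one hq0 hq1).sum_le_tsum _ fun j _ => by positivity
      calc _ ≤ K * W * r ^ s * (1 - q)⁻¹ := by gcongr
        _ = _ := by ring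
  · filter_upwards [ae_tendsto_corr_moll hu hrk hlim] with x hx
    exact hx.sub_const _

/-- Mollification at scale `r` maps `L¹` to `L^p`. -/
theorem exists_eLpNorm_corr_moll_le {p : ℝ≥0∞} (n : ℕ) (hp : 1 ≤ p) (hp' : p ≠ ⊤) :
    ∃ K : ℝ, 0 ≤ K ∧ ∀ (u : Euc n → ℝ) (N r : ℝ), Integrable u → ∫ x, |u x| ≤ N → 0 < r →
      eLpNorm (corr u (moll r)) p volume ≤
        ENNReal.ofReal (K * N * r ^ (-(n * (1 - 1 / p.toReal)))) := by
  obtain ⟨M, hM, hMb⟩ := exists_moll_le n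
  refine ⟨M + 1, by positivity, fun u N r hu hN hr => ?_⟩
  have hI : 0 ≤ ∫ x, |u x| := integral_nonneg fun _ => abs_nonneg _
  have h1 := corr_integral_bound hu (contDiff_moll r).continuous (hasCompactSupport_moll hr)
  have h2 := abs_corr_le hu (hMb r hr)
  rw [integral_abs_moll hr, one_mul] at h1
  have h3 := eLpNorm_le_of_sup_of_integral (e := 0) (c := (M + 1) * N) hp hp'
    (by have := hI.trans hN; positivity) hr h1.1
    (fun x => (h2 x).trans (by
      rw [zero_sub, mul_right_comm]
      gcongr
      linarith)) (h1.2.trans (by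
        rw [Real.rpow_zero]
        nlinarith))
  simpa using h3

/-- The higher integrability estimate, with a free scale `r`. -/
theorem exists_eLpNorm_le_of_derivBound [NeZero n] {α : ℝ≥0} (hα : α ≤ 1) {p : ℝ≥0∞}
    (hp : 1 ≤ p) (hp' : p ≠ ⊤) (hs : 0 < 1 - (α : ℝ) - n * (1 - 1 / p.toReal)) :
    ∃ K : ℝ, 0 ≤ K ∧ ∀ (u : Euc n → ℝ) (W N r : ℝ), Integrable u → 0 ≤ W → DerivBound α W u →
      ∫ x, |u x| ≤ N → 0 < r → eLpNorm u p volume ≤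
        ENNReal.ofReal (K * (W * r ^ (1 - (α : ℝ) - n * (1 - 1 / p.toReal)) +
          N * r ^ (-(n * (1 - 1 / p.toReal))))) := by
  obtain ⟨K, hK, hKb⟩ := exists_eLpNorm_sub_corr_moll_le (n := n) hα hp hp' hs
  obtain ⟨L, hL, hLb⟩ := exists_eLpNorm_corr_moll_le n hp hp'
  refine ⟨K + L, by positivity, fun u W N r hu hW hDW hN hr => ?_⟩
  have hN0 : 0 ≤ N := (integral_nonneg fun _ => abs_nonneg _).trans hN
  have hcont : Continuous (corr u (moll r)) :=
    continuous_corr hu (contDiff_moll _).continuous (hasCompactSupport_moll hr)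
  have h1 := eLpNorm_add_le (p := p) (hu.aestronglyMeasurable.sub hcont.aestronglyMeasurable)
    hcont.aestronglyMeasurable hp
  rw [sub_add_cancel] at h1
  refine h1.trans ((add_le_add (hKb u W r hu hW hDW hr) (hLb u N r hu hN hr)).trans ?_)
  rw [← ENNReal.ofReal_add (by positivity) (by positivity)]
  refine ENNReal.ofReal_le_ofReal ?_
  have a1 : 0 ≤ W * r ^ (1 - (α : ℝ) - n * (1 - 1 / p.toReal)) := by positivity
  have a2 : 0 ≤ N * r ^ (-(n * (1 - 1 / p.toReal))) := by positivity
  nlinarith [mul_nonneg hK a2, mul_nonneg hL a1]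

/-! ### Series of functions with summable norms -/

section Series

variable {X : Type*} [MeasurableSpace X] {μ : Measure X} {u : ℕ → X → ℝ}

theorem ae_hasSum_tsum (hu : ∀ k, AEStronglyMeasurable (u k) μ)
    (h : ∑' k, eLpNorm (u k) 1 μ ≠ ⊤) : ∀ᵐ x ∂μ, HasSum (fun k => u k x) (∑' k, u k x) := by
  simp only [eLpNorm_one_eq_lintegral_enorm] at h
  rw [← lintegral_tsum fun k => (hu k).enorm] at h
  filter_upwards [ae_lt_top' (AEMeasurable.tsum fun k => (hu k).enorm) h] with x hx
  have h1 : Summable fun k => ‖u k x‖₊ := by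
    rw [← ENNReal.tsum_coe_ne_top_iff_summable]
    exact hx.ne
  exact (Summable.of_nnnorm h1).hasSum

theorem eLpNorm_le_tsum {v : X → ℝ} {p : ℝ≥0∞} (hp : 1 ≤ p)
    (hu : ∀ k, AEStronglyMeasurable (u k) μ) (h : ∀ᵐ x ∂μ, HasSum (fun k => u k x) (v x)) :
    eLpNorm v p μ ≤ ∑' k, eLpNorm (u k) p μ := by
  refine eLpNorm_le_of_ae_tendsto (f := fun N => ∑ k ∈ Finset.range N, u k)
    (fun N => Finset.aestronglyMeasurable_sum _ fun k _ => hu k) (fun N => ?_) ?_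
  · exact (eLpNorm_sum_le (fun k _ => hu k) hp).trans (ENNReal.sum_le_tsum _)
  · filter_upwards [h] with x hx
    simpa only [Finset.sum_apply] using hx.tendsto_sum_nat

theorem tendsto_eLpNorm_sum_sub {v : X → ℝ} {p : ℝ≥0∞} (hp : 1 ≤ p)
    (hu : ∀ k, AEStronglyMeasurable (u k) μ) (h : ∀ᵐ x ∂μ, HasSum (fun k => u k x) (v x))
    (hsum : ∑' k, eLpNorm (u k) p μ ≠ ⊤) :
    Tendsto (fun N : ℕ => eLpNorm (fun x => (∑ k ∈ Finset.range N, u k x) - v x) p μ)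
      atTop (𝓝 0) := by
  refine tendsto_of_tendsto_of_tendsto_of_le_of_le tendsto_const_nhds
    (ENNReal.tendsto_sum_nat_add _ hsum) (fun _ => zero_le) fun N => ?_
  refine (eLpNorm_sub_comm (fun x => ∑ k ∈ Finset.range N, u k x) v p μ).le.trans ?_
  refine eLpNorm_le_tsum (u := fun k => u (k + N)) hp (fun k => hu _) ?_
  filter_upwards [h] with x hx
  exact (hasSum_nat_add_iff' N).2 hx

end Series

theorem tsum_le_of_le_geometric {f : ℕ → ℝ≥0∞} {c q : ℝ} (hc : 0 ≤ c) (hq0 : 0 ≤ q) (hq1 : q < 1)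
    (h : ∀ k, f k ≤ ENNReal.ofReal (c * q ^ k)) :
    ∑' k, f k ≤ ENNReal.ofReal (c * (1 - q)⁻¹) := by
  refine (ENNReal.tsum_le_tsum h).trans (le_of_eq ?_)
  rw [← ENNReal.ofReal_tsum_of_nonneg (fun k => by positivity)
    ((summable_geometric_of_lt_one hq0 hq1).mul_left c), tsum_mul_left,
    tsum_geometric_of_lt_one hq0 hq1]

/-! ### Weak compactness of bounded sequences in `L¹` with support in a compact set -/

/-- Integration of continuous functions on a compact set `K` against an integrable density. -/
theorem exists_functional {K : Set (Euc n)} [CompactSpace K] {u : Euc n → ℝ} (hu : Integrable u)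
    {N : ℝ} (hN : ∫ x, |u x| ≤ N) :
    ∃ Λ : StrongDual ℝ C(K, ℝ), ‖Λ‖ ≤ N ∧
      ∀ g : C(Euc n, ℝ), Λ (g.restrict K) = ∫ x in K, u x * g x := by
  have hK : IsCompact K := isCompact_iff_compactSpace.2 inferInstance
  have hN0 : 0 ≤ N := (integral_nonneg fun _ => abs_nonneg _).trans hN
  set ν : Measure K := Measure.comap Subtype.val volume with hν
  have hemb := MeasurableEmbedding.subtype_coe hK.measurableSet
  have hui : Integrable (fun x : K => u x) ν := by
    have h1 := (hemb.integrableOn_iff_comap (f := u) (μ := volume) (s := K) (by simp)).1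
      hu.integrableOn
    simpa [Function.comp_def] using h1
  have hgi : ∀ g : C(K, ℝ), Integrable (fun x : K => u x * g x) ν := fun g =>
    hui.mul_bdd (c := ‖g‖) g.continuous.measurable.aestronglyMeasurable
      (Eventually.of_forall fun x => g.norm_coe_le_norm x)
  let Λ : C(K, ℝ) →ₗ[ℝ] ℝ :=
    { toFun := fun g => ∫ x : K, u x * g x ∂ν
      map_add' := fun g g' => by
        simp only [ContinuousMap.add_apply, mul_add]
        exact integral_add (hgi g) (hgi g')
      map_smul' := fun c g => by
        simp only [ContinuousMap.smul_apply, smul_eq_mul, RingHom.id_apply, mul_left_comm _ c]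
        exact integral_const_mul _ _ }
  have hΛ : ∀ g, ‖Λ g‖ ≤ N * ‖g‖ := by
    intro g
    have h1 : ‖Λ g‖ ≤ ∫ x : K, |u x| * ‖g‖ ∂ν := by
      refine norm_integral_le_of_norm_le (hui.abs.mul_const _) (Eventually.of_forall fun x => ?_)
      rw [norm_mul, Real.norm_eq_abs]
      gcongr
      exact g.norm_coe_le_norm x
    rw [integral_mul_const, hν, integral_subtype_comap hK.measurableSet (fun x => |u x|)] at h1
    refine h1.trans ?_
    gcongr
    exact (setIntegral_le_integral hu.abs (Eventually.of_forall fun _ => abs_nonneg _)).trans hN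
  refine ⟨Λ.mkContinuous N hΛ, Λ.mkContinuous_norm_le hN0 hΛ, fun g => ?_⟩
  exact integral_subtype_comap hK.measurableSet (fun x => u x * g x)

/-- Along a subsequence, a bounded sequence in `L¹` with supports in a compact set converges weakly
against all continuous functions, by the sequential Banach–Alaoglu theorem in the dual of
`C(K, ℝ)`. -/
theorem exists_subseq_forall_continuous {K : Set (Euc n)} (hK : IsCompact K)
    {u : ℕ → Euc n → ℝ} (hu : ∀ j, Integrable (u j)) (hs : ∀ j, SupportedIn K (u j)) {N : ℝ}
    (hN : ∀ j, ∫ x, |u j x| ≤ N) :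
    ∃ s : ℕ → ℕ, StrictMono s ∧ ∀ g : Euc n → ℝ, Continuous g →
      ∃ l : ℝ, Tendsto (fun j => ∫ x, u (s j) x * g x) atTop (𝓝 l) := by
  have : CompactSpace K := isCompact_iff_compactSpace.1 hK
  choose Λ hΛn hΛ using fun j => exists_functional (K := K) (hu j) (hN j)
  obtain ⟨Λ₀, -, s, hsm, hlim⟩ := WeakDual.isSeqCompact_closedBall ℝ C(K, ℝ) 0 N
    (x := fun j => StrongDual.toWeakDual (Λ j)) (fun j => by simpa using hΛn j)
  refine ⟨s, hsm, fun g hg => ⟨Λ₀ ((⟨g, hg⟩ : C(Euc n, ℝ)).restrict K), ?_⟩⟩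
  have h1 := tendsto_iff_forall_eval_tendsto_topDualPairing.1 hlim
    ((⟨g, hg⟩ : C(Euc n, ℝ)).restrict K)
  refine h1.congr fun j => ?_
  refine (hΛ (s j) ⟨g, hg⟩).trans ?_
  rw [← integral_indicator hK.measurableSet]
  refine integral_congr_ae ?_
  filter_upwards [hs (s j)] with x hx
  by_cases hxK : x ∈ K
  · simp [Set.indicator_of_mem hxK]
  · simp [Set.indicator_of_notMem hxK, hx hxK]

/-- Dominated convergence in `L^p` for uniformly bounded functions with supports in a common
compact set. -/
theorem tendsto_eLpNorm_of_bounded_of_compact {p : ℝ≥0∞} (hp : 1 ≤ p) (hp' : p ≠ ⊤)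
    {f : ℕ → Euc n → ℝ} {w : Euc n → ℝ} (hf : ∀ j, Continuous (f j)) {B : ℝ}
    (hB : ∀ j x, |f j x| ≤ B) {L : Set (Euc n)} (hL : IsCompact L)
    (hfL : ∀ j, ∀ x ∉ L, f j x = 0) (hlim : ∀ x, Tendsto (fun j => f j x) atTop (𝓝 (w x))) :
    Tendsto (fun j => eLpNorm (fun x => f j x - w x) p volume) atTop (𝓝 0) := by
  have hp0 : p ≠ 0 := (zero_lt_one.trans_le hp).ne'
  have hq : 0 < p.toReal := ENNReal.toReal_pos hp0 hp'
  have hwm : Measurable w :=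
    measurable_of_tendsto_metrizable (fun j => (hf j).measurable) (tendsto_pi_nhds.2 hlim)
  have hwB : ∀ x, |w x| ≤ B := fun x =>
    le_of_tendsto (hlim x).abs (Eventually.of_forall fun j => hB j x)
  have hwL : ∀ x ∉ L, w x = 0 := fun x hx =>
    tendsto_nhds_unique (hlim x) (by simp [hfL _ x hx])
  simp only [eLpNorm_eq_lintegral_rpow_enorm_toReal hp0 hp']
  have h1 : Tendsto (fun j => ∫⁻ x, ‖f j x - w x‖ₑ ^ p.toReal) atTop
      (𝓝 (∫⁻ _ : Euc n, 0)) := by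
    refine tendsto_lintegral_of_dominated_convergence
      (L.indicator fun _ => ENNReal.ofReal (2 * B) ^ p.toReal)
      (fun j => (((hf j).measurable.sub hwm).enorm).pow_const _) (fun j => ?_) ?_ ?_
    · refine Eventually.of_forall fun x => ?_
      by_cases hx : x ∈ L
      · simp only [Set.indicator_of_mem hx]
        gcongr
        rw [Real.enorm_eq_ofReal_abs]
        refine ENNReal.ofReal_le_ofReal ((abs_sub _ _).trans ?_)
        linarith [hB j x, hwB x]
      · simp [Set.indicator_of_notMem hx, hfL j x hx, hwL x hx, hq]
    · rw [lintegral_indicator hL.measurableSet, setLIntegral_const]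
      exact ENNReal.mul_ne_top (ENNReal.rpow_ne_top_of_nonneg hq.le ENNReal.ofReal_ne_top)
        hL.measure_lt_top.ne
    · refine Eventually.of_forall fun x => ?_
      have h2 : Tendsto (fun j => ‖f j x - w x‖ₑ ^ p.toReal) atTop
          (𝓝 (‖w x - w x‖ₑ ^ p.toReal)) :=
        (((hlim x).sub_const (w x)).enorm).ennrpow_const _
      simpa [hq] using h2
  have h2 := h1.ennrpow_const (1 / p.toReal)
  simpa [hq] using h2

theorem eLpNorm_sub_le_add {X : Type*} [MeasurableSpace X] {μ : Measure X} {p : ℝ≥0∞} (hp : 1 ≤ p)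
    {f g h : X → ℝ} (hf : AEStronglyMeasurable f μ) (hg : AEStronglyMeasurable g μ)
    (hh : AEStronglyMeasurable h μ) :
    eLpNorm (f - h) p μ ≤ eLpNorm (f - g) p μ + eLpNorm (g - h) p μ := by
  simpa using eLpNorm_add_le (hf.sub hg) (hg.sub hh) hp

/-- A sequence that is uniformly approximated in `L^p` by convergent sequences converges. -/
theorem exists_tendsto_of_approx {X : Type*} [MeasurableSpace X] {μ : Measure X} {p : ℝ≥0∞}
    (hp : 1 ≤ p) {u : ℕ → X → ℝ} (hu : ∀ j, MemLp (u j) p μ)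
    (happ : ∀ ε : ℝ≥0∞, 0 < ε → ∃ (c : ℕ → X → ℝ) (w : X → ℝ),
      (∀ j, AEStronglyMeasurable (c j) μ) ∧ AEStronglyMeasurable w μ ∧
      (∀ j, eLpNorm (u j - c j) p μ ≤ ε) ∧
      Tendsto (fun j => eLpNorm (c j - w) p μ) atTop (𝓝 0)) :
    ∃ v : X → ℝ, MemLp v p μ ∧ Tendsto (fun j => eLpNorm (u j - v) p μ) atTop (𝓝 0) := by
  have : Fact (1 ≤ p) := ⟨hp⟩
  have hcau : CauchySeq fun j => (hu j).toLp (u j) := by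
    refine EMetric.cauchySeq_iff.2 fun ε hε => ?_
    have hε5 : 0 < ε / 5 := ENNReal.div_pos hε.ne' (by simp)
    obtain ⟨c, w, hc, hw, hcu, hcw⟩ := happ (min (ε / 5) 1) (lt_min hε5 one_pos)
    set δ := min (ε / 5) 1 with hδ
    have hδ0 : 0 < δ := lt_min hε5 one_pos
    have hδt : δ ≠ ⊤ := ne_top_of_le_ne_top ENNReal.one_ne_top (min_le_right _ _)
    obtain ⟨N, hN⟩ := eventually_atTop.1 (hcw.eventually_le_const hδ0)
    have key : ∀ j ≥ N, eLpNorm (u j - w) p μ ≤ δ + δ := fun j hj =>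
      (eLpNorm_sub_le_add hp (hu j).1 (hc j) hw).trans (add_le_add (hcu j) (hN j hj))
    refine ⟨N, fun i hi j hj => ?_⟩
    rw [Lp.edist_toLp_toLp]
    refine (eLpNorm_sub_le_add hp (hu i).1 hw (hu j).1).trans_lt ?_
    rw [eLpNorm_sub_comm w]
    refine (add_le_add (key i hi) (key j hj)).trans_lt ?_
    calc δ + δ + (δ + δ) < δ + δ + (δ + δ) + δ :=
          ENNReal.lt_add_right (by simp [hδt]) hδ0.ne'
      _ = 5 * δ := by ring
      _ ≤ 5 * (ε / 5) := by
          gcongr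
          exact min_le_left _ _
      _ = ε := ENNReal.mul_div_cancel (by simp) (by simp)
  obtain ⟨v, hv⟩ := cauchySeq_tendsto_of_complete hcau
  refine ⟨v, Lp.memLp v, ?_⟩
  have h1 := (Lp.tendsto_Lp_iff_tendsto_eLpNorm'' u hu v (Lp.memLp v)).1 (by simpa using hv)
  exact h1

theorem supportedIn_of_tendsto {p : ℝ≥0∞} (hp : 1 ≤ p) {K : Set (Euc n)} (hK : IsCompact K)
    {u : ℕ → Euc n → ℝ} {v : Euc n → ℝ} (hv : AEStronglyMeasurable v volume)
    (hs : ∀ j, SupportedIn K (u j))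
    (h : Tendsto (fun j => eLpNorm (u j - v) p volume) atTop (𝓝 0)) : SupportedIn K v := by
  have h1 : ∀ j, eLpNorm (Kᶜ.indicator v) p volume ≤ eLpNorm (u j - v) p volume := by
    intro j
    refine eLpNorm_mono_ae ?_
    filter_upwards [hs j] with x hx
    by_cases hxK : x ∈ K
    · simp [hxK]
    · simp [hxK, hx hxK]
  have h2 : eLpNorm (Kᶜ.indicator v) p volume = 0 :=
    le_antisymm (ge_of_tendsto h (Eventually.of_forall h1)) zero_le
  rw [eLpNorm_eq_zero_iff (hv.indicator hK.measurableSet.compl)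
    (zero_lt_one.trans_le hp).ne'] at h2
  filter_upwards [h2] with x hx hxK
  simpa [hxK] using hx

/-! ### Higher integrability and compactness -/

/-- The range of exponents, in the form in which it makes the geometric series converge. -/
theorem exponent_pos [NeZero n] {α : ℝ≥0} {p : ℝ≥0∞} (hp : 1 ≤ p)
    (hpn : p < (n : ℝ≥0∞) / ENNReal.ofReal ((n : ℝ) - 1 + (α : ℝ))) :
    p ≠ ⊤ ∧ 0 < 1 - (α : ℝ) - n * (1 - 1 / p.toReal) := by
  have hp' : p ≠ ⊤ := ne_top_of_lt hpn
  refine ⟨hp', ?_⟩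
  have hn : (1 : ℝ) ≤ n := by exact_mod_cast (NeZero.one_le : 1 ≤ n)
  have hc : 0 ≤ (n : ℝ) - 1 + α := by
    have := α.coe_nonneg
    linarith
  have hq : 1 ≤ p.toReal := by simpa using ENNReal.toReal_mono hp' hp
  have h1 := ENNReal.mul_lt_of_lt_div hpn
  have h2 : p.toReal * ((n : ℝ) - 1 + α) < n := by
    have := (ENNReal.toReal_lt_toReal (ENNReal.mul_ne_top hp' ENNReal.ofReal_ne_top)
      (ENNReal.natCast_ne_top n)).2 h1
    simpa [ENNReal.toReal_mul, ENNReal.toReal_ofReal hc] using this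
  have h3 : (n : ℝ) - 1 + α < n * (1 / p.toReal) := by
    rw [mul_one_div, lt_div_iff₀ (by linarith)]
    linarith
  linarith

theorem DerivBound.mono {α : ℝ≥0} {W W' : ℝ} {u : Euc n → ℝ} (h : DerivBound α W u)
    (hW : W ≤ W') : DerivBound α W' u := fun i C f hC hf hc hfα =>
  (h i C f hC hf hc hfα).trans (by gcongr)

theorem integral_abs_le_of_eLpNorm_le {u : Euc n → ℝ} (hu : MemLp u 1 volume) {N : ℝ} (hN : 0 ≤ N)
    (h : eLpNorm u 1 volume ≤ ENNReal.ofReal N) : ∫ x, |u x| ≤ N := by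
  rw [eLpNorm_one_eq_lintegral_enorm,
    ← ofReal_integral_norm_eq_lintegral_enorm (memLp_one_iff_integrable.1 hu)] at h
  exact (ENNReal.ofReal_le_ofReal_iff hN).1 h

/-- Each summand is estimated at its own scale `σ ^ (-k)`, where both terms of the estimate
decay at the same geometric rate. -/
theorem exists_series_bound [NeZero n] {α : ℝ≥0} {p : ℝ≥0∞} (hp : 1 ≤ p)
    (hpn : p < (n : ℝ≥0∞) / ENNReal.ofReal ((n : ℝ) - 1 + (α : ℝ))) {σ : ℝ≥0} (hσ : 1 < σ) :
    ∃ C : ℝ≥0, ∀ (V : ℝ≥0) (u : ℕ → Euc n → ℝ), (∀ k, MemBV (u k)) →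
      (∀ k : ℕ, eLpNorm (u k) 1 volume ≤
        ((V * σ ^ ((k : ℝ) * ((α : ℝ) - 1)) : ℝ≥0) : ℝ≥0∞)) →
      (∀ k : ℕ, totalVariation (u k) ≤ ((V * σ ^ ((k : ℝ) * (α : ℝ)) : ℝ≥0) : ℝ≥0∞)) →
      ∑' k, eLpNorm (u k) p volume ≤ (C : ℝ≥0∞) * (V : ℝ≥0∞) := by
  obtain ⟨hp', hs⟩ := exponent_pos hp hpn
  set θ : ℝ := n * (1 - 1 / p.toReal) with hθ
  have hσ' : (1 : ℝ) < σ := by exact_mod_cast hσ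
  have hσ0 : (0 : ℝ) < σ := by linarith
  have hs0 : 0 < 1 - ((0 : ℝ≥0) : ℝ) - n * (1 - 1 / p.toReal) := by
    have := α.coe_nonneg
    rw [NNReal.coe_zero]
    linarith
  obtain ⟨K, hK, hKb⟩ := exists_eLpNorm_le_of_derivBound (n := n) (α := 0) zero_le_one hp hp' hs0
  rw [← hθ] at hKb
  set q : ℝ := (σ : ℝ) ^ ((α : ℝ) - 1 + θ) with hq
  have hq0 : 0 ≤ q := by positivity
  have hq1 : q < 1 := Real.rpow_lt_one_of_one_lt_of_neg hσ' (by linarith)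
  refine ⟨(K * 2 * (1 - q)⁻¹).toNNReal, fun V u hu h1 h2 => ?_⟩
  have hC0 : 0 ≤ K * 2 * (1 - q)⁻¹ := mul_nonneg (by positivity) (inv_nonneg.2 (by linarith))
  have hterm : ∀ k, eLpNorm (u k) p volume ≤ ENNReal.ofReal (K * 2 * V * q ^ k) := by
    intro k
    have hW := (derivBound_of_totalVariation (hu k).2).mono
      (ENNReal.toReal_mono ENNReal.coe_ne_top (h2 k))
    have hN := integral_abs_le_of_eLpNorm_le (hu k).1 NNReal.zero_le_coe
      ((h1 k).trans (by rw [ENNReal.ofReal_coe_nnreal]))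
    refine (hKb (u k) _ _ ((σ : ℝ) ^ (-(k : ℝ))) (memLp_one_iff_integrable.1 (hu k).1)
      ENNReal.toReal_nonneg hW hN (by positivity)).trans (ENNReal.ofReal_le_ofReal (le_of_eq ?_))
    simp only [ENNReal.coe_toReal, NNReal.coe_mul, NNReal.coe_rpow, NNReal.coe_zero]
    have e1 : (σ : ℝ) ^ ((k : ℝ) * α) * ((σ : ℝ) ^ (-(k : ℝ))) ^ (1 - 0 - θ) = q ^ k := by
      rw [← Real.rpow_mul hσ0.le, ← Real.rpow_add hσ0, hq, ← Real.rpow_natCast,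
        ← Real.rpow_mul hσ0.le]
      congr 1
      ring
    have e2 : (σ : ℝ) ^ ((k : ℝ) * (α - 1)) * ((σ : ℝ) ^ (-(k : ℝ))) ^ (-θ) = q ^ k := by
      rw [← Real.rpow_mul hσ0.le, ← Real.rpow_add hσ0, hq, ← Real.rpow_natCast,
        ← Real.rpow_mul hσ0.le]
      congr 1
      ring
    rw [mul_assoc, mul_assoc, e1, e2]
    ring
  refine (tsum_le_of_le_geometric (by positivity) hq0 hq1 hterm).trans (le_of_eq ?_)
  rw [← ENNReal.ofReal_coe_nnreal, ← ENNReal.ofReal_coe_nnreal, ← ENNReal.ofReal_mul (by positivity),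
    Real.coe_toNNReal _ hC0]
  congr 1
  ring

theorem tsum_eLpNorm_one_ne_top {α : ℝ≥0} (hα : α < 1) {σ : ℝ≥0} (hσ : 1 < σ) {V : ℝ≥0}
    {u : ℕ → Euc n → ℝ} (h : ∀ k : ℕ, eLpNorm (u k) 1 volume ≤
        ((V * σ ^ ((k : ℝ) * ((α : ℝ) - 1)) : ℝ≥0) : ℝ≥0∞)) :
    ∑' k, eLpNorm (u k) 1 volume ≠ ⊤ := by
  have hσ' : (1 : ℝ) < σ := by exact_mod_cast hσ
  have hα' : (α : ℝ) < 1 := by exact_mod_cast hα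
  refine ne_top_of_le_ne_top ENNReal.ofReal_ne_top
    (tsum_le_of_le_geometric (c := V) (q := (σ : ℝ) ^ ((α : ℝ) - 1)) V.coe_nonneg (by positivity)
      (Real.rpow_lt_one_of_one_lt_of_neg hσ' (by linarith)) fun k => (h k).trans (le_of_eq ?_))
  rw [← ENNReal.ofReal_coe_nnreal, NNReal.coe_mul, NNReal.coe_rpow, mul_comm (k : ℝ),
    Real.rpow_mul_natCast σ.coe_nonneg]

theorem MemBVc.memLp [NeZero n] {α : ℝ≥0} (hα : α < 1) {p : ℝ≥0∞} (hp : 1 ≤ p)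
    (hpn : p < (n : ℝ≥0∞) / ENNReal.ofReal ((n : ℝ) - 1 + (α : ℝ))) {u : Euc n → ℝ}
    (hu : MemBVc α u) : MemLp u p volume := by
  obtain ⟨hp', hs⟩ := exponent_pos hp hpn
  obtain ⟨K, hK, hKb⟩ := exists_eLpNorm_le_of_derivBound (n := n) hα.le hp hp' hs
  have hui := memLp_one_iff_integrable.1 hu.1.1
  exact ⟨hui.aestronglyMeasurable, (hKb u _ _ 1 hui ENNReal.toReal_nonneg
    (derivBound_of_fracVariation hu.2) le_rfl one_pos).trans_lt ENNReal.ofReal_lt_top⟩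

/-- Mollification at a fixed scale is compact, and approximates the given functions uniformly in
`L^p`; hence a subsequence along which all mollifications converge pointwise converges in `L^p`. -/
theorem exists_subseq_tendsto [NeZero n] {α : ℝ≥0} (hα : α < 1) {p : ℝ≥0∞} (hp : 1 ≤ p)
    (hpn : p < (n : ℝ≥0∞) / ENNReal.ofReal ((n : ℝ) - 1 + (α : ℝ))) {K : Set (Euc n)}
    (hK : IsCompact K) {u : ℕ → Euc n → ℝ} (hu : ∀ j, MemBVc α (u j))
    (hs : ∀ j, SupportedIn K (u j)) {M : ℝ≥0}
    (hM : ∀ j, eLpNorm (u j) 1 volume + fracVariation α (u j) ≤ (M : ℝ≥0∞)) :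
    ∃ (v : Euc n → ℝ) (s : ℕ → ℕ), StrictMono s ∧ MemLpc p v ∧ SupportedIn K v ∧
      Tendsto (fun j : ℕ => eLpNorm (fun x => u (s j) x - v x) p volume) atTop (𝓝 0) := by
  obtain ⟨hp', hpos⟩ := exponent_pos hp hpn
  have hui : ∀ j, Integrable (u j) := fun j => memLp_one_iff_integrable.1 (hu j).1.1
  have hN : ∀ j, ∫ x, |u j x| ≤ M := fun j =>
    integral_abs_le_of_eLpNorm_le (hu j).1.1 M.coe_nonneg
      ((le_self_add.trans (hM j)).trans (by rw [ENNReal.ofReal_coe_nnreal]))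
  have hW : ∀ j, DerivBound α M (u j) := fun j =>
    (derivBound_of_fracVariation (hu j).2).mono
      (ENNReal.toReal_mono ENNReal.coe_ne_top (le_add_self.trans (hM j)))
  obtain ⟨A, hA, hAb⟩ := exists_eLpNorm_sub_corr_moll_le (n := n) hα.le hp hp' hpos
  set e : ℝ := 1 - (α : ℝ) - n * (1 - 1 / p.toReal) with he
  obtain ⟨s, hsm, hweak⟩ := exists_subseq_forall_continuous hK hui hs hN
  have happ : ∀ ε : ℝ≥0∞, 0 < ε → ∃ (c : ℕ → Euc n → ℝ) (w : Euc n → ℝ),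
      (∀ j, AEStronglyMeasurable (c j) volume) ∧ AEStronglyMeasurable w volume ∧
      (∀ j, eLpNorm (u (s j) - c j) p volume ≤ ε) ∧
      Tendsto (fun j => eLpNorm (c j - w) p volume) atTop (𝓝 0) := by
    intro ε hε
    have hsmall : Tendsto (fun r : ℝ => ENNReal.ofReal (A * M * r ^ e)) (𝓝[>] 0) (𝓝 0) := by
      have h1 : Tendsto (fun r : ℝ => A * M * r ^ e) (𝓝 0) (𝓝 (A * M * 0 ^ e)) :=
        (Real.continuousAt_rpow_const 0 e (Or.inr hpos.le)).tendsto.const_mul _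
      rw [Real.zero_rpow hpos.ne', mul_zero] at h1
      simpa using ENNReal.tendsto_ofReal (h1.mono_left nhdsWithin_le_nhds)
    obtain ⟨r, hrε, hr⟩ := ((hsmall.eventually_le_const hε).and self_mem_nhdsWithin).exists
    have hr0 : 0 < r := hr
    have hmc := (contDiff_moll (n := n) r).continuous
    have hms := hasCompactSupport_moll (n := n) hr0
    choose w hw using fun x : Euc n => hweak (fun y => moll r (y - x)) (by fun_prop)
    have hcont : ∀ j, Continuous (corr (u (s j)) (moll r)) := fun j =>
      continuous_corr (hui _) hmc hms
    have hwm : Measurable w := measurable_of_tendsto_metrizable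
      (fun j => (hcont j).measurable) (tendsto_pi_nhds.2 hw)
    refine ⟨fun j => corr (u (s j)) (moll r), w, fun j => (hcont j).aestronglyMeasurable,
      hwm.aestronglyMeasurable, fun j => ?_, ?_⟩
    · exact (hAb _ _ r (hui _) M.coe_nonneg (hW _) hr0).trans hrε
    · obtain ⟨B, hB⟩ := hms.exists_bound_of_continuous hmc
      -- The mollifications vanish outside the compact set `K - tsupport (moll r)`.
      refine tendsto_eLpNorm_of_bounded_of_compact hp hp' (B := B * M) hcont (fun j x => ?_)
        ((hK.prod hms).image (continuous_fst.sub continuous_snd)) (fun j x hx => ?_) hw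
      · refine (abs_corr_le (hui _) hB x).trans ?_
        have := (norm_nonneg _).trans (hB 0)
        gcongr
        exact hN _
      · refine integral_eq_zero_of_ae ?_
        filter_upwards [hs (s j)] with y hy
        by_cases hyK : y ∈ K
        · have : y - x ∉ tsupport (moll r : Euc n → ℝ) := fun h =>
            hx ⟨(y, y - x), ⟨hyK, h⟩, by simp⟩
          simp [image_eq_zero_of_notMem_tsupport this]
        · simp [hy hyK]
  obtain ⟨v, hv, hlim⟩ := exists_tendsto_of_approx hp (fun j => (hu (s j)).memLp hα hp hpn) happ
  have hvK := supportedIn_of_tendsto hp hK hv.1 (fun j => hs (s j)) hlim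
  exact ⟨v, s, hsm, ⟨hv, K, hK, hvK⟩, hvK, hlim⟩

end FracBV

end

theorem mainTheorem8 (n : ℕ) [NeZero n] (α : ℝ≥0) (hα : α < 1) (p : ℝ≥0∞) (hp : 1 ≤ p)
    (hpn : p < (n : ℝ≥0∞) / ENNReal.ofReal ((n : ℝ) - 1 + (α : ℝ))) :
    (∀ σ : ℝ≥0, 1 < σ → ∃ C : ℝ≥0, ∀ (V : ℝ≥0) (u : ℕ → FracBV.Euc n → ℝ),
      (∀ k, FracBV.MemBV (u k)) →
      (∀ k : ℕ, eLpNorm (u k) 1 volume ≤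
        ((V * σ ^ ((k : ℝ) * ((α : ℝ) - 1)) : ℝ≥0) : ℝ≥0∞)) →
      (∀ k : ℕ, FracBV.totalVariation (u k) ≤
        ((V * σ ^ ((k : ℝ) * (α : ℝ)) : ℝ≥0) : ℝ≥0∞)) →
      ∃ v : FracBV.Euc n → ℝ,
        MemLp v 1 volume ∧
        Tendsto (fun N : ℕ => eLpNorm (fun x => (∑ k ∈ Finset.range N, u k x) - v x) 1 volume)
          atTop (𝓝 0) ∧
        (∀ᵐ x ∂(volume : Measure (FracBV.Euc n)), HasSum (fun k => u k x) (v x)) ∧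
        MemLp v p volume ∧
        eLpNorm v p volume ≤ (C : ℝ≥0∞) * (V : ℝ≥0∞)) ∧
    (∀ u : FracBV.Euc n → ℝ, FracBV.MemBVc α u → FracBV.MemLpc p u) ∧
    (∀ K : Set (FracBV.Euc n), IsCompact K → ∀ u : ℕ → FracBV.Euc n → ℝ,
      (∀ j, FracBV.MemBVc α (u j)) → (∀ j, FracBV.SupportedIn K (u j)) →
      (∃ M : ℝ≥0, ∀ j, eLpNorm (u j) 1 volume + FracBV.fracVariation α (u j) ≤ (M : ℝ≥0∞)) →
      ∃ (v : FracBV.Euc n → ℝ) (s : ℕ → ℕ), StrictMono s ∧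
        FracBV.MemLpc p v ∧ FracBV.SupportedIn K v ∧
        Tendsto (fun j : ℕ => eLpNorm (fun x => u (s j) x - v x) p volume) atTop (𝓝 0)) := by
  refine ⟨fun σ hσ => ?_, fun u hu => ⟨hu.memLp hα hp hpn, hu.1.2⟩, ?_⟩
  · obtain ⟨C, hC⟩ := FracBV.exists_series_bound hp hpn hσ
    refine ⟨C, fun V u hu h1 h2 => ?_⟩
    have hm : ∀ k, AEStronglyMeasurable (u k) volume := fun k => (hu k).1.1
    have hsum := FracBV.tsum_eLpNorm_one_ne_top hα hσ h1
    have hae := FracBV.ae_hasSum_tsum hm hsum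
    have hvm : AEStronglyMeasurable (fun x => ∑' k, u k x) volume :=
      aestronglyMeasurable_of_tendsto_ae atTop
        (f := fun (N : ℕ) x => ∑ k ∈ Finset.range N, u k x)
        (fun N => Finset.aestronglyMeasurable_fun_sum _ fun k _ => hm k)
        (hae.mono fun x hx => hx.tendsto_sum_nat)
    have hvp := (FracBV.eLpNorm_le_tsum hp hm hae).trans (hC V u hu h1 h2)
    exact ⟨fun x => ∑' k, u k x,
      ⟨hvm, (FracBV.eLpNorm_le_tsum le_rfl hm hae).trans_lt hsum.lt_top⟩,
      FracBV.tendsto_eLpNorm_sum_sub le_rfl hm hae hsum, hae,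
      ⟨hvm, hvp.trans_lt (ENNReal.mul_lt_top ENNReal.coe_lt_top ENNReal.coe_lt_top)⟩, hvp⟩
  · rintro K hK u hu hs ⟨M, hM⟩
    exact FracBV.exists_subseq_tendsto hα hp hpn hK hu hs hM
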